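/- Let $p$ be a prime, $r\in\{1,\dots,p-1\}$, $\varepsilon\in[0,1]$ and $\mu\le 1-\frac rp$. A Max-LinSAT instance consists of a matrix $B\in\mathbb F_p^{m\times n}$ with $m>n\ge 1$ and rows $\mathbf b_1,\dots,\mathbf b_m$, and sets $F_1,\dots,F_m\subseteq\mathbb F_p$, here all with $|F_i|=r$; $\mathbf x\in\mathbb F_p^n$ satisfies the $i$-th constraint if $\mathbf b_i\cdot\mathbf x\in F_i$. Let $f_i$ be $1$ on $F_i$ and $-1$ off $F_i$, $f(\mathbf x)=\sum_i f_i(\mathbf b_i\cdot\mathbf x)$, $\bar f_i=\frac1p\sum_y f_i(y)$, $g_i=(f_i-\bar f_i)/\big(\sum_y|f_i(y)-\bar f_i|^2\big)^{1/2}$, and $$|P^{(k)}\rangle=\frac1{\sqrt{p^{n-k}\binom mk}}\sum_{\mathbf x\in\mathbb F_p^n}\ \sum_{S\subseteq[m],\,|S|=k}\ \prod_{i\in S}g_i(\mathbf b_i\cdot\mathbf x)\,|\mathbf x\rangle .$$ For a polynomial $P$ of degree at most $l$ such that $|P(f)\rangle=\sum_{\mathbf x}P(f(\mathbf x))|\mathbf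 x\rangle$ equals $\sum_{k=0}^l w_k|P^{(k)}\rangle$ with a unit vector $\mathbf w\in\mathbb C^{l+1}$, let $\langle s_D^{(m,l)}\rangle$ be the expected number of satisfied constraints when $\mathcal E^{\otimes n}(|P(f)\rangle\langle P(f)|)$ is measured in the computational basis, where $\mathcal E(\rho)=(1-\varepsilon)\rho+\varepsilon\operatorname{Tr}(\rho)I/p$. Let $\langle s_D^{(m,l)}\rangle_{\mathrm{opt}}$ be its supremum over all such $P$, and put $\tau_1(B,\varepsilon)=\frac1m\sum_{i=1}^m(1-\varepsilon)^{|\mathbf b_i|}$, where $|\mathbf b_i|$ is the number of nonzero entries of $\mathbf b_i$, and $$\beta=\mu-2\mu\frac rp+2\sqrt{\frac rp\Big(1-\frac rp\Big)}\sqrt{\mu(1-\mu)} .$$ Consider a sequence of such instances with numbers $l$ such that $m,l\to\infty$, $l/m=\mu$ for every member of the sequence, and $2l+1<d^\perp$, where $d^\perp$ is the minimum distance of the code $\{\mathbf v\in\mathbb F_p^m: B^T\mathbf v=\mathbf 0\}$; $n$, $B$ and the $F_i$ may vary along the sequence. 1. For each instance, let $A^{(m,l,d)}$ be the symmetric tridiagonal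 $(l+1)\times(l+1)$ matrix with diagonal $0,d,2d,\dots,ld$, $d=\frac{p-2r}{\sqrt{r(p-r)}}$, and off-diagonal entries $a_k=\sqrt{k(m-k+1)}$, $k=1,\dots,l$. Unit eigenvectors $\mathbf w$ for its largest eigenvalue exist; each of them is the coefficient vector of a polynomial $P$ of degree at most $l$ as above, and attains $\langle s_D^{(m,l)}\rangle_{\mathrm{opt}}$. 2. $\displaystyle \frac{\langle s_D^{(m,l)}\rangle_{\mathrm{opt}}}{m}-\Big(\frac rp+\tau_1(B,\varepsilon)\,\beta\Big)\longrightarrow 0 .$ In particular, if $\tau_1(B,\varepsilon)\to\tau$ along the sequence (for instance if it is constant, equal to $\tau$), then $$\lim_{\substack{m,l\to\infty\\ l/m=\mu}}\frac{\langle s_D^{(m,l)}\rangle_{\mathrm{opt}}}{m}=\frac rp+\tau\,\beta .$$ 3. If $L_1\le|\mathbf b_i|\le L_2$ for all rows of all the matrices $B$ in the sequence, then the lower and upper limits of $\frac1m\langle s_D^{(m,l)}\rangle_{\mathrm{opt}}-\frac rp$ lie between $(1-\varepsilon)^{L_2}\beta$ and $(1-\varepsilon)^{L_1}\beta$, and so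 does its limit whenever the limit exists. -/

import Mathlib

open Filter Topology Polynomial

noncomputable section

namespace NoisyDQI

/-- A `Max-LinSAT` instance over `𝔽_p` with `m` constraints `(B x)_i ∈ F_i` in `n` unknowns. -/
structure MaxLinSAT (p m n : ℕ) where
  B : Matrix (Fin m) (Fin n) (ZMod p)
  F : Fin m → Finset (ZMod p)

/-- The matrix element `⟨x| Φ^{⊗n}(ρ) |y⟩` of the `n`-fold tensor power of a linear map `Φ` on
`q × q` matrices: expand `ρ = ∑ ρ_{a b} ⨂_j |a_j⟩⟨b_j|` and apply `Φ` to every tensor factor. -/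
def tensorPower {κ : Type*} [Fintype κ] [DecidableEq κ] (n : ℕ)
    (Φ : Matrix κ κ ℂ →ₗ[ℂ] Matrix κ κ ℂ) (ρ : Matrix (Fin n → κ) (Fin n → κ) ℂ) :
    Matrix (Fin n → κ) (Fin n → κ) ℂ :=
  fun x y => ∑ a : Fin n → κ, ∑ b : Fin n → κ,
    ρ a b * ∏ j, Φ (Matrix.single (a j) (b j) 1) (x j) (y j)

/-- The depolarizing channel `ρ ↦ (1 - ε) ρ + ε Tr(ρ) I / p` on one qudit of dimension `p`. -/
def depolarizing (p : ℕ) [NeZero p] (ε : ℝ) :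
    Matrix (ZMod p) (ZMod p) ℂ →ₗ[ℂ] Matrix (ZMod p) (ZMod p) ℂ :=
  (1 - (ε : ℂ)) • LinearMap.id
    + ((ε : ℂ) / (p : ℂ)) • (Matrix.traceLinearMap (ZMod p) ℂ ℂ).smulRight 1

/-- The density matrix `|ψ⟩⟨ψ|`. -/
def density {κ : Type*} (ψ : κ → ℂ) : Matrix κ κ ℂ :=
  Matrix.vecMulVec ψ (star ψ)

/-- The minimum (Hamming) distance of a code; it is `⊤` when the code has at most one word. -/
def minDistance {ι K : Type*} [Fintype ι] [DecidableEq K] (C : Set (ι → K)) : ℕ∞ :=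
  ⨅ (u ∈ C) (v ∈ C) (_ : u ≠ v), (hammingDist u v : ℕ∞)

/-- The code `C^⊥ = {v : Bᵀ v = 0}`. -/
def dualCode {p m n : ℕ} (B : Matrix (Fin m) (Fin n) (ZMod p)) : Set (Fin m → ZMod p) :=
  {v | B.transpose.mulVec v = 0}

/-- `τ₁(B, ε)`: the average over the rows `b_i` of `B` of `(1 - ε) ^ |b_i|`, where `|b_i|` is the
number of nonzero entries of `b_i`. -/
def tau1 {p m n : ℕ} (B : Matrix (Fin m) (Fin n) (ZMod p)) (ε : ℝ) : ℝ :=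
  (∑ i, (1 - ε) ^ hammingNorm (B i)) / m

/-- The symmetric tridiagonal `(l+1) × (l+1)` matrix `A^{(m,l,d)}` with diagonal entries
`0, d, 2d, …, l d` and off-diagonal entries `a_k = √(k (m - k + 1))`, `k = 1, …, l`, the entry `a_k`
standing in the positions `(k-1, k)` and `(k, k-1)` (indices starting at `0`). -/
def tridiagonal (m l : ℕ) (d : ℝ) : Matrix (Fin (l + 1)) (Fin (l + 1)) ℝ :=
  fun i j =>
    if i = j then (i : ℝ) * d
    else if (i : ℕ) + 1 = (j : ℕ) then Real.sqrt ((j : ℝ) * ((m : ℝ) - (j : ℝ) + 1))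
    else if (j : ℕ) + 1 = (i : ℕ) then Real.sqrt ((i : ℝ) * ((m : ℝ) - (i : ℝ) + 1))
    else 0

/-- `w` is a normalized principal eigenvector of the real square matrix `A`: a unit vector that is
an eigenvector for the largest eigenvalue of `A`. -/
def IsPrincipalEigenvector {l : ℕ} (A : Matrix (Fin l) (Fin l) ℝ)
    (w : EuclideanSpace ℂ (Fin l)) : Prop :=
  ‖w‖ = 1 ∧ ∃ lam : ℝ, IsGreatest {x : ℝ | Module.End.HasEigenvalue (Matrix.toLin' A) x} lam ∧
    ∀ i, ∑ j, (A i j : ℂ) * w j = (lam : ℂ) * w i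

namespace MaxLinSAT

variable {p m n : ℕ} (I : MaxLinSAT p m n)

/-- The `±1`-valued indicator function `f_i` of `F_i`. -/
def f (i : Fin m) (y : ZMod p) : ℝ := if y ∈ I.F i then 1 else -1

/-- The objective function `f(x) = ∑ i, f_i (b_i · x)`. -/
def objective (x : Fin n → ZMod p) : ℝ := ∑ i, I.f i (I.B.mulVec x i)

/-- The number of constraints that `x` satisfies. -/
def satisfied (x : Fin n → ZMod p) : ℕ :=
  (Finset.univ.filter fun i => I.B.mulVec x i ∈ I.F i).card

/-- The state `|P(f)⟩ = ∑ x, P(f(x)) |x⟩` of a polynomial `P`, in the computational basis. -/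
def polyState (P : ℂ[X]) : (Fin n → ZMod p) → ℂ :=
  fun x => P.eval (I.objective x : ℂ)

variable [NeZero p]

/-- The mean value of `f_i`. -/
def fMean (i : Fin m) : ℝ := (∑ y, I.f i y) / p

/-- The normalization `φ` of `f_i` minus its mean value. -/
def phi (i : Fin m) : ℝ := Real.sqrt (∑ y, |I.f i y - I.fMean i| ^ 2)

/-- The centred and normalized function `g_i`. -/
def g (i : Fin m) (y : ZMod p) : ℝ := (I.f i y - I.fMean i) / I.phi i

/-- `P^{(k)}(g_1(b_1 · x), …, g_m(b_m · x))`: the sum over the `k`-element sets `{i_1, …, i_k}` of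
constraints of the products of the `g_i(b_i · x)`. -/
def elemSym (k : ℕ) (x : Fin n → ZMod p) : ℝ :=
  ∑ S ∈ (Finset.univ : Finset (Fin m)).powersetCard k, ∏ i ∈ S, I.g i (I.B.mulVec x i)

/-- The state `|P^{(k)}⟩`, in the computational basis. -/
def basisState (k : ℕ) : (Fin n → ZMod p) → ℂ :=
  fun x => ((1 / Real.sqrt ((p : ℝ) ^ ((n : ℤ) - (k : ℤ)) * (m.choose k : ℝ)) * I.elemSym k x : ℝ) : ℂ)

/-- The DQI state `∑ k ≤ l, w_k |P^{(k)}⟩`. -/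
def dqiState {l : ℕ} (w : EuclideanSpace ℂ (Fin (l + 1))) : (Fin n → ZMod p) → ℂ :=
  fun x => ∑ k : Fin (l + 1), w k * I.basisState k x

/-- The expected number of satisfied constraints when the noisy state `ℰ^{⊗n}(|ψ⟩⟨ψ|)`, with `ℰ` the
depolarizing channel of strength `ε`, is measured in the computational basis: the outcome `x` has
probability `⟨x| ℰ^{⊗n}(|ψ⟩⟨ψ|) |x⟩`. -/
def expectedSatisfied (ε : ℝ) (ψ : (Fin n → ZMod p) → ℂ) : ℝ :=
  ∑ x, (tensorPower n (depolarizing p ε) (density ψ) x x).re * (I.satisfied x : ℝ)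

/-- The values of `⟨s_D^{(m,l)}⟩` over all degree-`l` polynomials `P` (the coefficient of degree `l`
may vanish) for which `|P(f)⟩ = ∑ k ≤ l, w_k |P^{(k)}⟩` with a unit vector `w`. -/
def achievable (l : ℕ) (ε : ℝ) : Set ℝ :=
  {s | ∃ (P : ℂ[X]) (w : EuclideanSpace ℂ (Fin (l + 1))), P.natDegree ≤ l ∧ ‖w‖ = 1 ∧
    I.polyState P = I.dqiState w ∧ s = I.expectedSatisfied ε (I.polyState P)}

/-- The optimal value `⟨s_D^{(m,l)}⟩_opt`. -/
def optSatisfied (l : ℕ) (ε : ℝ) : ℝ := sSup (I.achievable l ε)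

end MaxLinSAT

/-- The bracket `μ - 2 μ q + 2 √(q (1 - q)) √(μ (1 - μ))`, where `q = r / p`. -/
def bracket (q μ : ℝ) : ℝ :=
  μ - 2 * μ * q + 2 * Real.sqrt (q * (1 - q)) * Real.sqrt (μ * (1 - μ))

end NoisyDQI

end

/-! Only the diagonal of the noisy state matters, and there the depolarizing channel acts
classically: each coordinate is kept with weight `1 - ε` and replaced by a uniform one with weight
`ε`. Resampling one coordinate in the support of `b_i` averages a centred function of `b_i · x` to
zero, so `g_i(b_i · x)` is an eigenfunction of the noise with eigenvalue `(1 - ε) ^ |b_i|`. The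
number of satisfied constraints is a constant plus a multiple of `∑ g_i(b_i · x)`.

Since `2l + 1 < d^⊥`, any `2l + 1` rows of `B` are linearly independent, so the values `b_i · x`
that occur in the second moments of a degree-`l` state behave like independent uniform variables.
The `|P^(k)⟩` are therefore orthonormal, and the matrix elements of `g_i` between them are those of
`A / (m √p)`, whatever `i` is. The expectation is thus `m r/p + √(q(1-q)) τ₁ w†Aw` with `q = r/p`
(`expectedSatisfied_dqiState`): noise enters only through the scalar `τ₁ ≥ 0`, and the optimum is
the largest eigenvalue of `A`. Every `w` is admissible because, by Newton's identities, the
elementary symmetric functions of the two-valued `g_i` are polynomials in `f`.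

Divided by `m`, that eigenvalue tends to `μ d + 2√(μ(1-μ))`: Gershgorin's bound gives the upper
estimate, a block of ones at the last coordinates the lower one. The Gershgorin rows are largest
near `k = l` because `x d + 2√(x(1-x))` increases on `[0, 1 - q]`; this is where `μ ≤ 1 - r/p` is
needed. As `τ₁ ≤ 1`, the convergence is uniform in `B`. -/

namespace NoisyDQI

/-! ### Depolarizing noise on measurement outcomes -/

/-- The transition probabilities of the classical channel that the depolarizing channel induces on
measurement outcomes. -/
noncomputable def depolarizingKernel (p : ℕ) (ε : ℝ) (a x : ZMod p) : ℝ :=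
  (1 - ε) * (if a = x then 1 else 0) + ε / p

/-- Coherences never reach the diagonal, so the outcome statistics depend only on the populations
`|ψ(a)|²`. -/
theorem depolarizing_single_apply_self (p : ℕ) [NeZero p] (ε : ℝ) (a b x : ZMod p) :
    depolarizing p ε (Matrix.single a b 1) x x =
      if a = b then (depolarizingKernel p ε a x : ℂ) else 0 := by
  by_cases hab : a = b
  · subst hab
    by_cases hx : a = x <;>
      simp [depolarizing, depolarizingKernel, hx]
  · have : ¬ (a = x ∧ b = x) := fun h => hab (h.1.trans h.2.symm)
    simp [depolarizing, hab, this]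

theorem tensorPower_depolarizing_apply_self (p n : ℕ) [NeZero p] (ε : ℝ)
    (ρ : Matrix (Fin n → ZMod p) (Fin n → ZMod p) ℂ) (x : Fin n → ZMod p) :
    tensorPower n (depolarizing p ε) ρ x x =
      ∑ a, ρ a a * ((∏ j, depolarizingKernel p ε (a j) (x j) : ℝ) : ℂ) := by
  unfold tensorPower
  refine Finset.sum_congr rfl fun a _ => ?_
  rw [Finset.sum_eq_single a]
  · simp [depolarizing_single_apply_self]
  · intro b _ hb
    obtain ⟨j, hj⟩ := Function.ne_iff.mp hb
    rw [Finset.prod_eq_zero (Finset.mem_univ j), mul_zero]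
    rw [depolarizing_single_apply_self, if_neg (Ne.symm hj)]
  · simp

theorem sum_depolarizingKernel (p : ℕ) [NeZero p] (ε : ℝ) (a : ZMod p) :
    ∑ x, depolarizingKernel p ε a x = 1 := by
  have hp : (p : ℝ) ≠ 0 := Nat.cast_ne_zero.mpr (NeZero.ne p)
  simp only [depolarizingKernel, Finset.sum_add_distrib, ← Finset.mul_sum]
  simp [ZMod.card]
  field_simp
  ring

theorem sum_prod_depolarizingKernel (p n : ℕ) [NeZero p] (ε : ℝ) (a : Fin n → ZMod p) :
    ∑ x : Fin n → ZMod p, ∏ j, depolarizingKernel p ε (a j) (x j) = 1 := by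
  have := Finset.prod_univ_sum (fun _ : Fin n => (Finset.univ : Finset (ZMod p)))
    (fun j y => depolarizingKernel p ε (a j) y)
  rw [Fintype.piFinset_univ] at this
  rw [← this]
  simp [sum_depolarizingKernel]

theorem sum_comp_add_mul {p : ℕ} [Fact p.Prime] (h : ZMod p → ℝ) (c b : ZMod p) (hb : b ≠ 0) :
    ∑ y, h (c + b * y) = ∑ y, h y :=
  Fintype.sum_equiv ((Equiv.mulLeft₀ b hb).trans (Equiv.addLeft c)) _ _ fun _ => rfl

/-- For `b ≠ 0` the map `y ↦ c + b y` permutes `𝔽_p`, so the uniform part of the kernel averages the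
centred `h` to zero and only the factor `1 - ε` remains. -/
theorem sum_depolarizingKernel_mul {p : ℕ} [Fact p.Prime] (ε : ℝ) (h : ZMod p → ℝ)
    (hh : ∑ y, h y = 0) (a b c : ZMod p) :
    ∑ x, depolarizingKernel p ε a x * h (c + b * x) =
      (if b ≠ 0 then 1 - ε else 1) * h (c + b * a) := by
  by_cases hb : b = 0
  · subst hb
    simp [← Finset.sum_mul, sum_depolarizingKernel]
  · simp only [depolarizingKernel, add_mul, Finset.sum_add_distrib]
    rw [← Finset.mul_sum, sum_comp_add_mul h c b hb, hh]
    simp [hb]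

/-- Depolarizing noise multiplies the mean of a centred function of `b · x` by `(1 - ε) ^ |b|`. -/
theorem sum_prod_depolarizingKernel_mul {p : ℕ} [Fact p.Prime] (ε : ℝ) (h : ZMod p → ℝ)
    (hh : ∑ y, h y = 0) {n : ℕ} (a b : Fin n → ZMod p) (c : ZMod p) :
    ∑ x : Fin n → ZMod p, (∏ j, depolarizingKernel p ε (a j) (x j)) * h (c + b ⬝ᵥ x) =
      (1 - ε) ^ hammingNorm b * h (c + b ⬝ᵥ a) := by
  have key : ∑ x : Fin n → ZMod p, (∏ j, depolarizingKernel p ε (a j) (x j)) * h (c + b ⬝ᵥ x) =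
      (∏ j, if b j ≠ 0 then 1 - ε else 1) * h (c + b ⬝ᵥ a) := by
    -- The offset `c` absorbs the coordinates that are already summed out.
    induction n generalizing c with
    | zero => simp [dotProduct]
    | succ n ih =>
      rw [← (Fin.consEquiv fun _ : Fin (n + 1) => ZMod p).sum_comp, Fintype.sum_prod_type_right]
      have inner : ∀ y : Fin n → ZMod p,
          ∑ z : ZMod p, (∏ j, depolarizingKernel p ε (a j)
              ((Fin.consEquiv fun _ : Fin (n + 1) => ZMod p) (z, y) j)) *
            h (c + b ⬝ᵥ (Fin.consEquiv fun _ : Fin (n + 1) => ZMod p) (z, y)) =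
          (if b 0 ≠ 0 then 1 - ε else 1) *
            ((∏ j, depolarizingKernel p ε (Fin.tail a j) (y j)) *
              h ((c + b 0 * a 0) + Fin.tail b ⬝ᵥ y)) := by
        intro y
        have := sum_depolarizingKernel_mul ε h hh (a 0) (b 0) (c + Fin.tail b ⬝ᵥ y)
        rw [show c + b 0 * a 0 + Fin.tail b ⬝ᵥ y = c + Fin.tail b ⬝ᵥ y + b 0 * a 0 by ring,
          mul_left_comm, ← this, Finset.mul_sum]
        refine Finset.sum_congr rfl fun z _ => ?_
        simp only [Fin.consEquiv_apply, Fin.prod_univ_succ, dotProduct, Fin.sum_univ_succ,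
          Fin.cons_zero, Fin.cons_succ, Fin.tail]
        rw [show c + (b 0 * z + ∑ i : Fin n, b i.succ * y i) =
          c + ∑ i : Fin n, b i.succ * y i + b 0 * z by ring]
        ring
      rw [Finset.sum_congr rfl fun y _ => inner y, ← Finset.mul_sum,
        ih (Fin.tail a) (Fin.tail b), Fin.prod_univ_succ]
      simp only [dotProduct, Fin.sum_univ_succ, Fin.tail]
      rw [← add_assoc, mul_assoc]
      congr!
  rw [key, Finset.prod_ite]
  simp [hammingNorm]

theorem expectedSatisfied_eq_sum {p m n : ℕ} [NeZero p] (I : MaxLinSAT p m n) (ε : ℝ)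
    (ψ : (Fin n → ZMod p) → ℂ) :
    I.expectedSatisfied ε ψ = ∑ a, Complex.normSq (ψ a) *
      ∑ x : Fin n → ZMod p, (∏ j, depolarizingKernel p ε (a j) (x j)) * (I.satisfied x : ℝ) := by
  unfold MaxLinSAT.expectedSatisfied
  simp only [tensorPower_depolarizing_apply_self, Complex.re_sum, Complex.re_mul_ofReal,
    Finset.sum_mul, Finset.mul_sum]
  rw [Finset.sum_comm]
  refine Finset.sum_congr rfl fun a _ => Finset.sum_congr rfl fun x _ => ?_
  have : (density ψ a a).re = Complex.normSq (ψ a) := by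
    simp [density, Matrix.vecMulVec_apply, Complex.normSq_apply]
  rw [this, mul_assoc]

/-! ### Dual distance and independence of rows -/

theorem minDistance_le_hammingNorm {p m n : ℕ} (B : Matrix (Fin m) (Fin n) (ZMod p))
    {u : Fin m → ZMod p} (hu : B.transpose.mulVec u = 0) (h0 : u ≠ 0) :
    minDistance (dualCode B) ≤ (hammingNorm u : ℕ∞) := by
  refine (iInf₂_le u hu).trans ((iInf₂_le (0 : Fin m → ZMod p) ?_).trans ((iInf_le _ h0).trans ?_))
  · simp [dualCode]
  · simp

/-- As `n < m`, `Bᵀ` has a nonzero kernel vector, and its weight is at most `m`. This is what forces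
`l < m` later. -/
theorem minDistance_le_length {p m n : ℕ} [Fact p.Prime] (B : Matrix (Fin m) (Fin n) (ZMod p))
    (hmn : n < m) : minDistance (dualCode B) ≤ (m : ℕ∞) := by
  have : ¬ Function.Injective (Matrix.mulVecLin B.transpose) := fun h => by
    have := LinearMap.finrank_le_finrank_of_injective h
    simp at this
    omega
  rw [← LinearMap.ker_eq_bot, Submodule.eq_bot_iff] at this
  push Not at this
  obtain ⟨u, hu, h0⟩ := this
  refine (minDistance_le_hammingNorm B hu h0).trans ?_
  exact_mod_cast (hammingNorm_le_card_fintype (x := u)).trans (by simp)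

/-- Fewer rows than the dual distance are independent: one of them can be moved alone. -/
theorem exists_mulVec_eq_one {p m n : ℕ} [Fact p.Prime] (B : Matrix (Fin m) (Fin n) (ZMod p))
    (T : Finset (Fin m)) (j : Fin m) (hj : j ∉ T)
    (hT : ((T.card + 1 : ℕ) : ℕ∞) < minDistance (dualCode B)) :
    ∃ v, B.mulVec v j = 1 ∧ ∀ i ∈ T, B.mulVec v i = 0 := by
  by_cases hs : B j ∈ Submodule.span (ZMod p) (B '' (T : Set (Fin m)))
  · exfalso
    obtain ⟨c, hc⟩ := (Submodule.mem_span_image_finset_iff_exists_fun' (ZMod p)).mp hs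
    -- A dependence of row `j` on the rows in `T` is a nonzero dual codeword of weight at most `|T|
    -- + 1`, too light to exist.
    set u : Fin m → ZMod p := fun i => (if i ∈ T then c i else 0) - Pi.single (M := fun _ => ZMod p) j 1 i with hu
    have huj : u j = -1 := by simp [hu, hj]
    have h0 : u ≠ 0 := fun h => by simp [h] at huj
    have hker : B.transpose.mulVec u = 0 := by
      funext k
      have := congrFun hc k
      simp only [Finset.sum_apply, Pi.smul_apply, smul_eq_mul] at this
      simp only [Matrix.mulVec, dotProduct, Matrix.transpose_apply, hu, mul_sub,
        Finset.sum_sub_distrib, Pi.zero_apply]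
      simp only [mul_ite, mul_zero, Finset.sum_ite_mem, Finset.univ_inter, Pi.single_apply, mul_one,
        Finset.sum_ite_eq', Finset.mem_univ, if_true]
      rw [← this, sub_eq_zero]
      exact Finset.sum_congr rfl fun i _ => mul_comm _ _
    have hle : hammingNorm u ≤ T.card + 1 := by
      rw [← Finset.card_insert_of_notMem hj]
      refine Finset.card_le_card fun i hi => ?_
      by_contra hni
      rw [Finset.mem_insert, not_or] at hni
      simp [hu, hni.1, hni.2] at hi
    have := hT.trans_le (minDistance_le_hammingNorm B hker h0)
    have := Nat.cast_lt.mp this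
    omega
  -- A functional that kills the span but not row `j`, rescaled to be `1` there, is the dot product
  -- with the required `v`.
  · obtain ⟨φ, hφ, hker⟩ := Submodule.exists_le_ker_of_notMem hs
    have hmul : ∀ i, B.mulVec (fun k => (φ (B j))⁻¹ * φ (Pi.single k 1)) i =
        (φ (B j))⁻¹ * φ (B i) := fun i => by
      conv_rhs => rw [LinearMap.pi_apply_eq_sum_univ φ (B i), Finset.mul_sum]
      simp only [Matrix.mulVec, dotProduct]
      refine Finset.sum_congr rfl fun k _ => ?_
      rw [smul_eq_mul, mul_left_comm]
      congr 3
      ext t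
      simp [Pi.single_apply, eq_comm]
    refine ⟨_, (hmul j).trans (inv_mul_cancel₀ hφ), fun i hi => (hmul i).trans ?_⟩
    rw [show φ (B i) = 0 from hker (Submodule.subset_span ⟨i, hi, rfl⟩), mul_zero]

/-- A function of `b_j · x` and one that depends only on the `b_i · x`, `i ∈ T`, are independent. -/
theorem sum_mul_eq_of_notMem {p m n : ℕ} [Fact p.Prime] (B : Matrix (Fin m) (Fin n) (ZMod p))
    (T : Finset (Fin m)) (j : Fin m) (hj : j ∉ T)
    (hT : ((T.card + 1 : ℕ) : ℕ∞) < minDistance (dualCode B)) (h : ZMod p → ℝ)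
    (R : (Fin n → ZMod p) → ℝ)
    (hR : ∀ x v, (∀ i ∈ T, B.mulVec v i = 0) → R (x + v) = R x) :
    (p : ℝ) * ∑ x, h (B.mulVec x j) * R x = (∑ y, h y) * ∑ x, R x := by
  obtain ⟨v, hvj, hv⟩ := exists_mulVec_eq_one B T j hj hT
  -- Translating `x` by `t • v` shifts `b_j · x` by `t` and leaves `R` fixed; summing over all `t`
  -- makes `b_j · x` uniform independently of `R`.
  have hshift : ∀ t : ZMod p, ∑ x, h (B.mulVec x j) * R x = ∑ x, h (B.mulVec x j + t) * R x := by
    intro t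
    refine (Fintype.sum_equiv (Equiv.addRight (t • v)) _ _ fun x => ?_).symm
    rw [Equiv.coe_addRight, hR x (t • v) fun i hi => by simp [Matrix.mulVec_smul, hv i hi],
      Matrix.mulVec_add, Matrix.mulVec_smul]
    simp [hvj]
  calc (p : ℝ) * ∑ x, h (B.mulVec x j) * R x
      = ∑ t : ZMod p, ∑ x, h (B.mulVec x j + t) * R x := by
        rw [← Finset.sum_congr rfl fun t _ => hshift t]
        simp [ZMod.card]
    _ = ∑ x, (∑ t : ZMod p, h (B.mulVec x j + t)) * R x := by
        rw [Finset.sum_comm]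
        simp only [Finset.sum_mul]
    _ = _ := by
        rw [Finset.mul_sum]
        refine Finset.sum_congr rfl fun x _ => ?_
        congr 1
        exact Fintype.sum_equiv (Equiv.addLeft (B.mulVec x j)) _ _ fun _ => rfl

/-! ### Moments of elementary symmetric functions of the rows -/

section Moments

variable {p m n : ℕ} (B : Matrix (Fin m) (Fin n) (ZMod p)) (u : Fin m → ZMod p → ℝ)

/-- The product of the `u_i(b_i · x)` over `i ∈ S`. -/
def rowProd (S : Finset (Fin m)) (x : Fin n → ZMod p) : ℝ := ∏ i ∈ S, u i (B.mulVec x i)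

/-- The `k`-th elementary symmetric function of the `u_i(b_i · x)`, `i ∈ U`. -/
def rowEsymm (U : Finset (Fin m)) (k : ℕ) (x : Fin n → ZMod p) : ℝ :=
  ∑ S ∈ U.powersetCard k, rowProd B u S x

theorem rowProd_add_of_forall {S T : Finset (Fin m)} (hST : S ⊆ T) (x v : Fin n → ZMod p)
    (hv : ∀ i ∈ T, B.mulVec v i = 0) : rowProd B u S (x + v) = rowProd B u S x :=
  Finset.prod_congr rfl fun i hi => by
    rw [Matrix.mulVec_add, Pi.add_apply, hv i (hST hi), add_zero]

variable [Fact p.Prime]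

theorem mul_sum_apply_mul_rowProd (S S' : Finset (Fin m)) (i : Fin m) (hi : i ∉ S) (hi' : i ∉ S')
    (hd : ((S.card + S'.card + 1 : ℕ) : ℕ∞) < minDistance (dualCode B)) (h : ZMod p → ℝ) :
    (p : ℝ) * ∑ x, h (B.mulVec x i) * (rowProd B u S x * rowProd B u S' x) =
      (∑ y, h y) * ∑ x, rowProd B u S x * rowProd B u S' x := by
  refine sum_mul_eq_of_notMem B (S ∪ S') i (by simp [hi, hi']) (lt_of_le_of_lt ?_ hd) h _ ?_
  · exact_mod_cast Nat.succ_le_succ (Finset.card_union_le S S')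
  · intro x v hv
    rw [rowProd_add_of_forall B u Finset.subset_union_left x v hv,
      rowProd_add_of_forall B u Finset.subset_union_right x v hv]

variable (h1 : ∀ i, ∑ y, u i y = 0) (h2 : ∀ i, ∑ y, u i y ^ 2 = 1)
include h1

/-- A factor `u_i` that occurs in just one of the products is independent of all the others and has
mean zero. -/
theorem sum_rowProd_mul_eq_zero {S S' : Finset (Fin m)} {i : Fin m} (hi : i ∈ S) (hi' : i ∉ S')
    (hd : ((S.card + S'.card : ℕ) : ℕ∞) < minDistance (dualCode B)) :
    ∑ x, rowProd B u S x * rowProd B u S' x = 0 := by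
  have hcard := Finset.card_erase_add_one hi
  have := mul_sum_apply_mul_rowProd B u (S.erase i) S' i (by simp) hi'
    (by rwa [add_right_comm, hcard]) (u i)
  rw [h1, zero_mul] at this
  rw [← (mul_eq_zero.mp this).resolve_left (Nat.cast_ne_zero.mpr (NeZero.ne p))]
  refine Finset.sum_congr rfl fun x _ => ?_
  rw [← mul_assoc]
  congr 1
  exact (Finset.mul_prod_erase S (fun i => u i (B.mulVec x i)) hi).symm

omit h1 in
include h2 in
theorem sum_rowProd_mul_self {S : Finset (Fin m)}
    (hd : ((S.card + S.card : ℕ) : ℕ∞) < minDistance (dualCode B)) :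
    ∑ x, rowProd B u S x * rowProd B u S x = (p : ℝ) ^ n / (p : ℝ) ^ S.card := by
  have hp : (p : ℝ) ≠ 0 := Nat.cast_ne_zero.mpr (NeZero.ne p)
  induction S using Finset.induction_on with
  | empty => simp [rowProd, ZMod.card]
  | insert i S hi ih =>
    rw [Finset.card_insert_of_notMem hi] at hd ⊢
    have hd' : ((S.card + S.card + 1 : ℕ) : ℕ∞) < minDistance (dualCode B) :=
      lt_of_le_of_lt (by exact_mod_cast (by omega : _ ≤ _)) hd
    have ih := ih (lt_of_le_of_lt (by exact_mod_cast (by omega : _ ≤ _)) hd')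
    have := mul_sum_apply_mul_rowProd B u S S i hi hi hd' fun y => u i y ^ 2
    rw [h2, one_mul, ih] at this
    rw [pow_succ, ← div_div, ← this, mul_div_cancel_left₀ _ hp]
    refine Finset.sum_congr rfl fun x _ => ?_
    simp only [rowProd, Finset.prod_insert hi]
    ring

include h2

theorem sum_rowProd_mul_rowProd (S S' : Finset (Fin m))
    (hd : ((S.card + S'.card : ℕ) : ℕ∞) < minDistance (dualCode B)) :
    ∑ x, rowProd B u S x * rowProd B u S' x =
      if S = S' then (p : ℝ) ^ n / (p : ℝ) ^ S.card else 0 := by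
  split_ifs with h
  · subst h
    exact sum_rowProd_mul_self B u h2 hd
  · by_cases hsub : S ⊆ S'
    · obtain ⟨i, hi', hi⟩ := Finset.exists_of_ssubset (Finset.ssubset_iff_subset_ne.mpr ⟨hsub, h⟩)
      rw [← sum_rowProd_mul_eq_zero B u h1 hi' hi (by rwa [add_comm])]
      exact Finset.sum_congr rfl fun x _ => mul_comm _ _
    · obtain ⟨i, hi, hi'⟩ := Finset.not_subset.mp hsub
      exact sum_rowProd_mul_eq_zero B u h1 hi hi' hd

theorem sum_rowEsymm_mul_rowEsymm (U : Finset (Fin m)) (s t : ℕ)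
    (hd : ((s + t : ℕ) : ℕ∞) < minDistance (dualCode B)) :
    ∑ x, rowEsymm B u U s x * rowEsymm B u U t x =
      if s = t then (U.card.choose s : ℝ) * ((p : ℝ) ^ n / (p : ℝ) ^ s) else 0 := by
  simp only [rowEsymm, Finset.sum_mul_sum]
  rw [Finset.sum_comm]
  have hS : ∀ S ∈ U.powersetCard s, ∑ x, ∑ S' ∈ U.powersetCard t,
      rowProd B u S x * rowProd B u S' x = if s = t then (p : ℝ) ^ n / (p : ℝ) ^ s else 0 := by
    intro S hS
    have hSc := (Finset.mem_powersetCard.mp hS).2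
    rw [Finset.sum_comm, Finset.sum_congr rfl fun S' hS' => sum_rowProd_mul_rowProd B u h1 h2 S S'
      (by rwa [hSc, (Finset.mem_powersetCard.mp hS').2])]
    rw [Finset.sum_ite_eq, hSc]
    have : S ∈ U.powersetCard t ↔ s = t := by
      rw [Finset.mem_powersetCard] at hS ⊢
      simp [hS.1, hS.2]
    simp only [this]
  rw [Finset.sum_congr rfl hS]
  split_ifs <;> simp

theorem mul_sum_apply_mul_rowEsymm (U : Finset (Fin m)) (i : Fin m) (hi : i ∉ U) (s t : ℕ)
    (hd : ((s + t + 1 : ℕ) : ℕ∞) < minDistance (dualCode B)) (h : ZMod p → ℝ) :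
    (p : ℝ) * ∑ x, h (B.mulVec x i) * (rowEsymm B u U s x * rowEsymm B u U t x) =
      (∑ y, h y) *
        if s = t then (U.card.choose s : ℝ) * ((p : ℝ) ^ n / (p : ℝ) ^ s) else 0 := by
  have hd' : ((s + t : ℕ) : ℕ∞) < minDistance (dualCode B) :=
    lt_of_le_of_lt (by exact_mod_cast Nat.le_succ _) hd
  rw [← sum_rowEsymm_mul_rowEsymm B u h1 h2 U s t hd']
  have e1 : ∀ S ∈ U.powersetCard s, ∀ S' ∈ U.powersetCard t,
      (p : ℝ) * ∑ x, h (B.mulVec x i) * (rowProd B u S x * rowProd B u S' x) =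
      (∑ y, h y) * ∑ x, rowProd B u S x * rowProd B u S' x := by
    intro S hS S' hS'
    rw [Finset.mem_powersetCard] at hS hS'
    exact mul_sum_apply_mul_rowProd B u S S' i (fun h => hi (hS.1 h)) (fun h => hi (hS'.1 h))
      (by rwa [hS.2, hS'.2]) h
  have swap : ∀ F : (Fin n → ZMod p) → Finset (Fin m) → Finset (Fin m) → ℝ,
      ∑ x, ∑ S ∈ U.powersetCard s, ∑ S' ∈ U.powersetCard t, F x S S' =
        ∑ S ∈ U.powersetCard s, ∑ S' ∈ U.powersetCard t, ∑ x, F x S S' := fun F => by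
    rw [Finset.sum_comm]
    exact Finset.sum_congr rfl fun S _ => Finset.sum_comm
  generalize ∑ y, h y = σ at e1 ⊢
  simp only [rowEsymm, Finset.sum_mul_sum]
  simp only [Finset.mul_sum] at e1 ⊢
  rw [swap, swap]
  exact Finset.sum_congr rfl fun S hS => Finset.sum_congr rfl fun S' hS' => e1 S hS S' hS'

omit h1 h2 [Fact p.Prime] in
theorem rowEsymm_zero (U : Finset (Fin m)) (x : Fin n → ZMod p) : rowEsymm B u U 0 x = 1 := by
  simp [rowEsymm, rowProd]

-- Sorting the subsets by whether they contain `i` isolates the dependence on row `i`, which can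
-- then be integrated out.
omit h1 h2 [Fact p.Prime] in
theorem rowEsymm_succ (i : Fin m) (k : ℕ) (x : Fin n → ZMod p) :
    rowEsymm B u Finset.univ (k + 1) x = rowEsymm B u (Finset.univ.erase i) (k + 1) x +
      u i (B.mulVec x i) * rowEsymm B u (Finset.univ.erase i) k x := by
  have hi : i ∉ Finset.univ.erase i := Finset.notMem_erase _ _
  unfold rowEsymm
  conv_lhs => rw [← Finset.insert_erase (Finset.mem_univ i), Finset.powersetCard_succ_insert hi]
  have hn : ∀ (j : ℕ), ∀ S ∈ (Finset.univ.erase i).powersetCard j, i ∉ S := fun j S hS h =>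
    hi ((Finset.mem_powersetCard.mp hS).1 h)
  rw [Finset.sum_union, Finset.sum_image, Finset.mul_sum]
  · congr 1
    refine Finset.sum_congr rfl fun S hS => ?_
    exact Finset.prod_insert (hn k S hS)
  · intro S hS S' hS' he
    rw [← Finset.erase_insert (hn k S hS), ← Finset.erase_insert (hn k S' hS')]
    exact congrArg (fun V => Finset.erase V i) he
  · rw [Finset.disjoint_left]
    intro S hS hS'
    obtain ⟨V, _, rfl⟩ := Finset.mem_image.mp hS'
    exact hn _ _ hS (Finset.mem_insert_self _ _)

/-- The (unnormalized) matrix elements of `u_i(b_i · x)` between the elementary symmetric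
functions. -/
theorem mul_sum_apply_mul_rowEsymm_univ {γ : ℝ} (i : Fin m) (h3 : ∑ y, u i y ^ 3 = γ) (k k' : ℕ)
    (hd : ((k + k' + 1 : ℕ) : ℕ∞) < minDistance (dualCode B)) :
    (p : ℝ) * ∑ x, u i (B.mulVec x i) *
        (rowEsymm B u Finset.univ k x * rowEsymm B u Finset.univ k' x) =
      if k = k' then
        (if k = 0 then 0 else γ * (((m - 1).choose (k - 1) : ℝ) * ((p : ℝ) ^ n / (p : ℝ) ^ (k - 1))))
      else if k + 1 = k' then ((m - 1).choose k : ℝ) * ((p : ℝ) ^ n / (p : ℝ) ^ k)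
      else if k' + 1 = k then ((m - 1).choose k' : ℝ) * ((p : ℝ) ^ n / (p : ℝ) ^ k')
      else 0 := by
  have hi : i ∉ Finset.univ.erase i := Finset.notMem_erase _ _
  have hc : (Finset.univ.erase i).card = m - 1 := by simp
  have key := fun (s t : ℕ) (hst : s + t ≤ k + k') (h : ZMod p → ℝ) =>
    mul_sum_apply_mul_rowEsymm B u h1 h2 _ i hi s t
      (lt_of_le_of_lt (by exact_mod_cast Nat.succ_le_succ hst) hd) h
  simp only [hc] at key
  match k, k' with
  | 0, 0 =>
    have := key 0 0 le_rfl (u i)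
    simp only [rowEsymm_zero, h1] at this ⊢
    simp only [this]
    simp
  | k + 1, 0 =>
    have e1 := key (k + 1) 0 (by omega) (u i)
    have e2 := key k 0 (by omega) fun y => u i y ^ 2
    rw [h1, zero_mul] at e1
    rw [h2, one_mul] at e2
    have : ∑ x, u i (B.mulVec x i) *
        (rowEsymm B u Finset.univ (k + 1) x * rowEsymm B u Finset.univ 0 x) =
        ∑ x, u i (B.mulVec x i) * (rowEsymm B u (Finset.univ.erase i) (k + 1) x *
          rowEsymm B u (Finset.univ.erase i) 0 x) +
        ∑ x, u i (B.mulVec x i) ^ 2 * (rowEsymm B u (Finset.univ.erase i) k x *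
          rowEsymm B u (Finset.univ.erase i) 0 x) := by
      rw [← Finset.sum_add_distrib]
      refine Finset.sum_congr rfl fun x _ => ?_
      rw [rowEsymm_succ B u i, rowEsymm_zero, rowEsymm_zero]
      ring
    rw [this, mul_add, e1, e2]
    by_cases hk : k = 0
    · subst hk; simp
    · simp [hk]
  | 0, k + 1 =>
    have e1 := key (k + 1) 0 (by omega) (u i)
    have e2 := key k 0 (by omega) fun y => u i y ^ 2
    rw [h1, zero_mul] at e1
    rw [h2, one_mul] at e2
    have : ∑ x, u i (B.mulVec x i) *
        (rowEsymm B u Finset.univ 0 x * rowEsymm B u Finset.univ (k + 1) x) =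
        ∑ x, u i (B.mulVec x i) * (rowEsymm B u (Finset.univ.erase i) (k + 1) x *
          rowEsymm B u (Finset.univ.erase i) 0 x) +
        ∑ x, u i (B.mulVec x i) ^ 2 * (rowEsymm B u (Finset.univ.erase i) k x *
          rowEsymm B u (Finset.univ.erase i) 0 x) := by
      rw [← Finset.sum_add_distrib]
      refine Finset.sum_congr rfl fun x _ => ?_
      rw [rowEsymm_succ B u i, rowEsymm_zero, rowEsymm_zero]
      ring
    rw [this, mul_add, e1, e2]
    by_cases hk : k = 0
    · subst hk; simp
    · simp [hk]
  | k + 1, k' + 1 =>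
    have e1 := key (k + 1) (k' + 1) (by omega) (u i)
    have e2 := key (k + 1) k' (by omega) fun y => u i y ^ 2
    have e3 := key k (k' + 1) (by omega) fun y => u i y ^ 2
    have e4 := key k k' (by omega) fun y => u i y ^ 3
    rw [h1, zero_mul] at e1
    rw [h2, one_mul] at e2 e3
    rw [h3] at e4
    -- The four terms carry `u_i` to the powers 1, 2, 2, 3, with moments 0, 1, 1, `γ`. The squares
    -- give the entries next to the diagonal, the cube the diagonal itself.
    have : ∑ x, u i (B.mulVec x i) *
        (rowEsymm B u Finset.univ (k + 1) x * rowEsymm B u Finset.univ (k' + 1) x) =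
        ∑ x, u i (B.mulVec x i) * (rowEsymm B u (Finset.univ.erase i) (k + 1) x *
          rowEsymm B u (Finset.univ.erase i) (k' + 1) x) +
        ∑ x, u i (B.mulVec x i) ^ 2 * (rowEsymm B u (Finset.univ.erase i) (k + 1) x *
          rowEsymm B u (Finset.univ.erase i) k' x) +
        ∑ x, u i (B.mulVec x i) ^ 2 * (rowEsymm B u (Finset.univ.erase i) k x *
          rowEsymm B u (Finset.univ.erase i) (k' + 1) x) +
        ∑ x, u i (B.mulVec x i) ^ 3 * (rowEsymm B u (Finset.univ.erase i) k x *
          rowEsymm B u (Finset.univ.erase i) k' x) := by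
      simp only [← Finset.sum_add_distrib]
      refine Finset.sum_congr rfl fun x _ => ?_
      rw [rowEsymm_succ B u i, rowEsymm_succ B u i]
      ring
    rw [this, mul_add, mul_add, mul_add, e1, e2, e3, e4]
    simp only [Nat.add_right_cancel_iff, Nat.add_sub_cancel, Nat.succ_ne_zero, if_false]
    by_cases h : k = k'
    · subst h; simp
    · by_cases ha : k + 1 = k'
      · subst ha; simp [show k ≠ k + 1 + 1 by omega]
      · by_cases hb : k' + 1 = k
        · subst hb; simp [show k' + 1 + 1 ≠ k' by omega]
        · simp [h, ha, hb, Ne.symm hb]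

end Moments

/-! ### Moments of the centred indicators -/

namespace MaxLinSAT

section Statistics

variable {p m n : ℕ} (I : MaxLinSAT p m n) {r : ℕ}

theorem sum_comp_f [NeZero p] (φ : ℝ → ℝ) (i : Fin m) (hF : (I.F i).card = r) (hrp : r ≤ p) :
    ∑ y, φ (I.f i y) = r * φ 1 + (p - r) * φ (-1) := by
  have h1 : ∀ y, φ (I.f i y) = if y ∈ I.F i then φ 1 else φ (-1) := fun y => by
    unfold f; split_ifs <;> rfl
  simp only [h1, Finset.sum_ite, Finset.sum_const, nsmul_eq_mul]
  have h2 : (Finset.univ.filter fun y => y ∈ I.F i).card = r := by simp [hF]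
  have h3 : (Finset.univ.filter fun y => y ∉ I.F i).card = p - r := by
    rw [← Finset.compl_filter, Finset.card_compl, h2, ZMod.card]
  rw [h2, h3, Nat.cast_sub hrp]

theorem fMean_eq [NeZero p] (i : Fin m) (hF : (I.F i).card = r) (hrp : r ≤ p) :
    I.fMean i = (2 * r - p) / p := by
  rw [fMean, I.sum_comp_f (fun y => y) i hF hrp]
  ring

theorem phi_sq_eq [NeZero p] (i : Fin m) (hF : (I.F i).card = r) (hrp : r ≤ p) :
    I.phi i ^ 2 = 4 * (r * (p - r) / p) := by
  have hp : (p : ℝ) ≠ 0 := Nat.cast_ne_zero.mpr (NeZero.ne p)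
  rw [phi, Real.sq_sqrt (Finset.sum_nonneg fun _ _ => by positivity)]
  simp only [sq_abs]
  rw [I.sum_comp_f (fun y => (y - I.fMean i) ^ 2) i hF hrp, I.fMean_eq i hF hrp]
  field_simp
  ring

theorem phi_eq [NeZero p] (i : Fin m) (hF : (I.F i).card = r) (hrp : r ≤ p) :
    I.phi i = 2 * Real.sqrt (r * (p - r) / p) := by
  have hrp' : (r : ℝ) ≤ p := by exact_mod_cast hrp
  have h : 0 ≤ (r * (p - r) / p : ℝ) :=
    div_nonneg (mul_nonneg (Nat.cast_nonneg _) (sub_nonneg.mpr hrp')) (Nat.cast_nonneg _)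
  refine (sq_eq_sq₀ (a := I.phi i) (Real.sqrt_nonneg _) (by positivity)).mp ?_
  rw [I.phi_sq_eq i hF hrp, mul_pow, Real.sq_sqrt h]
  norm_num

theorem phi_pos [NeZero p] (i : Fin m) (hF : (I.F i).card = r) (hr : 0 < r) (hrp : r < p) :
    0 < I.phi i := by
  have hr' : (0 : ℝ) < r := by exact_mod_cast hr
  have hrp' : (0 : ℝ) < p - r := sub_pos.mpr (by exact_mod_cast hrp)
  have hp : (0 : ℝ) < p := by exact_mod_cast hr.trans hrp
  rw [I.phi_eq i hF hrp.le]
  positivity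

theorem sum_g_pow [NeZero p] (i : Fin m) (hF : (I.F i).card = r) (hrp : r ≤ p) (k : ℕ) :
    ∑ y, I.g i y ^ k =
      (r * (2 * (p - r) / p : ℝ) ^ k + (p - r) * (-(2 * r / p) : ℝ) ^ k) / I.phi i ^ k := by
  have hp : (p : ℝ) ≠ 0 := Nat.cast_ne_zero.mpr (NeZero.ne p)
  have := I.sum_comp_f (fun y => ((y - I.fMean i) / I.phi i) ^ k) i hF hrp
  simp only [g]
  rw [this, I.fMean_eq i hF hrp]
  rw [show (1 - (2 * r - p) / p : ℝ) = 2 * (p - r) / p by field_simp; ring,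
    show (-1 - (2 * r - p) / p : ℝ) = -(2 * r / p) by field_simp; ring]
  rw [div_pow _ (I.phi i), div_pow _ (I.phi i)]
  ring

theorem sum_g [NeZero p] (i : Fin m) (hF : (I.F i).card = r) (hrp : r ≤ p) :
    ∑ y, I.g i y = 0 := by
  have := I.sum_g_pow i hF hrp 1
  simp only [pow_one] at this
  rw [this]
  ring

theorem sum_g_sq [NeZero p] (i : Fin m) (hF : (I.F i).card = r) (hr : 0 < r) (hrp : r < p) :
    ∑ y, I.g i y ^ 2 = 1 := by
  have hp : (p : ℝ) ≠ 0 := Nat.cast_ne_zero.mpr (NeZero.ne p)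
  have hr' : (r : ℝ) ≠ 0 := by exact_mod_cast hr.ne'
  have hrp' : (p - r : ℝ) ≠ 0 := (sub_pos.mpr (by exact_mod_cast hrp)).ne'
  rw [I.sum_g_pow i hF hrp.le, I.phi_sq_eq i hF hrp.le]
  field_simp
  ring

/-- This third moment is `d / √p`, the source of the diagonal of the tridiagonal matrix. -/
theorem sum_g_cube [NeZero p] (i : Fin m) (hF : (I.F i).card = r) (hr : 0 < r) (hrp : r < p) :
    ∑ y, I.g i y ^ 3 = (p - 2 * r) / Real.sqrt (r * (p - r)) / Real.sqrt p := by
  have hr' : (0 : ℝ) < r := by exact_mod_cast hr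
  have hrp' : (0 : ℝ) < p - r := sub_pos.mpr (by exact_mod_cast hrp)
  have hp : (0 : ℝ) < p := by exact_mod_cast hr.trans hrp
  rw [I.sum_g_pow i hF hrp.le, pow_succ (I.phi i) 2, I.phi_sq_eq i hF hrp.le,
    I.phi_eq i hF hrp.le, Real.sqrt_div' _ hp.le]
  have h1 := Real.sqrt_pos.mpr hp
  have h2 := Real.sqrt_pos.mpr (mul_pos hr' hrp')
  have h3 := Real.sq_sqrt hp.le
  field_simp
  rw [h3]
  ring

/-- The number of satisfied constraints in terms of the functions `g_i`. -/
theorem satisfied_eq [NeZero p] (hF : ∀ i, (I.F i).card = r) (hr : 0 < r) (hrp : r < p)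
    (x : Fin n → ZMod p) :
    (I.satisfied x : ℝ) =
      ∑ i, ((r : ℝ) / p + Real.sqrt (r * (p - r) / p) * I.g i (I.B.mulVec x i)) := by
  have hp : (p : ℝ) ≠ 0 := Nat.cast_ne_zero.mpr (NeZero.ne p)
  rw [satisfied, Finset.card_filter, Nat.cast_sum]
  refine Finset.sum_congr rfl fun i _ => ?_
  have h1 : Real.sqrt (r * (p - r) / p) * I.g i (I.B.mulVec x i) =
      (I.f i (I.B.mulVec x i) - I.fMean i) / 2 := by
    have := I.phi_pos i (hF i) hr hrp
    rw [g, ← mul_div_assoc, div_eq_div_iff this.ne' two_ne_zero, I.phi_eq i (hF i) hrp.le]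
    ring
  rw [h1, I.fMean_eq i (hF i) hrp.le, f]
  split_ifs <;> · field_simp; ring

end Statistics

/-! ### Noisy expectation and its matrix elements -/

section Expectation

variable {p m n r : ℕ} [Fact p.Prime] (I : MaxLinSAT p m n)

/-- Linear in the centred `g_i`, each damped by its own noise eigenvalue; this holds for every `ψ`,
with no condition on the distance. -/
theorem expectedSatisfied_eq (hF : ∀ i, (I.F i).card = r) (hr : 0 < r) (hrp : r < p) (ε : ℝ)
    (ψ : (Fin n → ZMod p) → ℂ) :
    I.expectedSatisfied ε ψ =
      m * (r / p) * ∑ x, Complex.normSq (ψ x) + Real.sqrt (r * (p - r) / p) *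
        ∑ i, (1 - ε) ^ hammingNorm (I.B i) *
          ∑ x, Complex.normSq (ψ x) * I.g i (I.B.mulVec x i) := by
  have key : ∀ a : Fin n → ZMod p,
      ∑ x : Fin n → ZMod p, (∏ j, depolarizingKernel p ε (a j) (x j)) * (I.satisfied x : ℝ) =
      m * (r / p) + Real.sqrt (r * (p - r) / p) *
        ∑ i, (1 - ε) ^ hammingNorm (I.B i) * I.g i (I.B.mulVec a i) := by
    intro a
    simp only [I.satisfied_eq hF hr hrp, Finset.mul_sum, Finset.sum_add_distrib, mul_add]
    congr 1
    · simp [← Finset.mul_sum, ← Finset.sum_mul, sum_prod_depolarizingKernel]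
    · rw [Finset.sum_comm]
      refine Finset.sum_congr rfl fun i _ => ?_
      have := sum_prod_depolarizingKernel_mul ε (I.g i) (I.sum_g i (hF i) hrp.le) a (I.B i) 0
      simp only [zero_add] at this
      change _ = _ * (_ * I.g i (I.B i ⬝ᵥ a))
      rw [← this, Finset.mul_sum]
      exact Finset.sum_congr rfl fun x _ => mul_left_comm _ _ _
  rw [expectedSatisfied_eq_sum]
  simp only [key, mul_add, Finset.sum_add_distrib, Finset.mul_sum]
  congr 1
  · exact Finset.sum_congr rfl fun x _ => mul_comm _ _
  · rw [Finset.sum_comm]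
    refine Finset.sum_congr rfl fun i _ => Finset.sum_congr rfl fun x _ => ?_
    ring

/-- The normalized elementary symmetric functions, as real functions. -/
noncomputable def realBasis (k : ℕ) (x : Fin n → ZMod p) : ℝ :=
  1 / Real.sqrt ((p : ℝ) ^ ((n : ℤ) - (k : ℤ)) * (m.choose k : ℝ)) * I.elemSym k x

theorem realBasis_normalization {p : ℕ} (hp : 0 < (p : ℝ)) (n k : ℕ) :
    (p : ℝ) ^ ((n : ℤ) - (k : ℤ)) = (p : ℝ) ^ n / (p : ℝ) ^ k := by
  rw [zpow_sub₀ hp.ne', zpow_natCast, zpow_natCast]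

theorem sum_realBasis_mul (hF : ∀ i, (I.F i).card = r) (hr : 0 < r) (hrp : r < p) (k k' : ℕ)
    (hd : ((k + k' : ℕ) : ℕ∞) < minDistance (dualCode I.B)) (hk : k ≤ m) :
    ∑ x, I.realBasis k x * I.realBasis k' x = if k = k' then 1 else 0 := by
  have hp : (0 : ℝ) < p := by exact_mod_cast hr.trans hrp
  have := sum_rowEsymm_mul_rowEsymm I.B I.g (fun i => I.sum_g i (hF i) hrp.le)
    (fun i => I.sum_g_sq i (hF i) hr hrp) Finset.univ k k' hd
  have e : ∑ x, I.realBasis k x * I.realBasis k' x =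
      1 / Real.sqrt ((p : ℝ) ^ ((n : ℤ) - (k : ℤ)) * (m.choose k : ℝ)) *
      (1 / Real.sqrt ((p : ℝ) ^ ((n : ℤ) - (k' : ℤ)) * (m.choose k' : ℝ))) *
      ∑ x, rowEsymm I.B I.g Finset.univ k x * rowEsymm I.B I.g Finset.univ k' x := by
    rw [Finset.mul_sum]
    exact Finset.sum_congr rfl fun x _ => mul_mul_mul_comm _ _ _ _
  rw [e, this]
  split_ifs with h
  · subst h
    have hc : (0 : ℝ) < m.choose k := by exact_mod_cast Nat.choose_pos hk
    rw [realBasis_normalization hp, Finset.card_univ, Fintype.card_fin, ← mul_div_mul_comm,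
      Real.mul_self_sqrt (by positivity)]
    field_simp
  · rw [mul_zero]

/-- The value is the same for all `i`, so that summing the weights `(1 - ε) ^ |b_i|` produces
exactly `m τ₁`. -/
theorem sum_g_mul_realBasis_mul (hF : ∀ i, (I.F i).card = r) (hr : 0 < r) (hrp : r < p) (i : Fin m)
    {l : ℕ} (k k' : Fin (l + 1))
    (hd : ((2 * l + 1 : ℕ) : ℕ∞) < minDistance (dualCode I.B)) (hl : l < m) :
    ∑ x, I.g i (I.B.mulVec x i) * (I.realBasis k x * I.realBasis k' x) =
      tridiagonal m l (((p : ℝ) - 2 * r) / Real.sqrt (r * ((p : ℝ) - r))) k k' /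
        (m * Real.sqrt p) := by
  have hp : (0 : ℝ) < p := by exact_mod_cast hr.trans hrp
  have hm : (0 : ℝ) < m := by exact_mod_cast (Nat.zero_le l).trans_lt hl
  have hsp := Real.sqrt_pos.mpr hp
  have hsp2 := Real.sq_sqrt hp.le
  have hchoose : ∀ k ≤ m, (0 : ℝ) < m.choose k := fun k hk => by exact_mod_cast Nat.choose_pos hk
  have c1 : ∀ j : ℕ, (m : ℝ) * ((m - 1).choose j : ℝ) = (m.choose (j + 1) : ℝ) * (j + 1) := by
    intro j
    have := Nat.add_one_mul_choose_eq (m - 1) j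
    rw [Nat.sub_add_cancel (by omega)] at this
    exact_mod_cast this
  have c2 : ∀ j : ℕ, j ≤ l → (m.choose (j + 1) : ℝ) * (j + 1) = m.choose j * (m - j) := by
    intro j hj
    have := Nat.choose_succ_right_eq m j
    rw [← Nat.cast_sub (by omega : j ≤ m)]
    exact_mod_cast this
  -- By the absorption identities `c1` and `c2`, `C(m-1, j) / √(C(m, j) C(m, j+1)) = √((j+1)(m-j)) /
  -- m`; the powers of `p` leave `1/√p`.
  have off : ∀ j : ℕ, j + 1 ≤ l →
      1 / Real.sqrt ((p : ℝ) ^ n / (p : ℝ) ^ j * (m.choose j : ℝ)) *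
      (1 / Real.sqrt ((p : ℝ) ^ n / (p : ℝ) ^ (j + 1) * (m.choose (j + 1) : ℝ))) *
      (((m - 1).choose j : ℝ) * ((p : ℝ) ^ n / (p : ℝ) ^ j) / p) =
      Real.sqrt (((j + 1 : ℕ) : ℝ) * ((m : ℝ) - ((j + 1 : ℕ) : ℝ) + 1)) / (m * Real.sqrt p) := by
    intro j hj
    have h0 := hchoose j (by omega)
    have h1 := hchoose (j + 1) (by omega)
    have hmj : (0 : ℝ) < m - j := sub_pos.mpr (by exact_mod_cast (by omega : j < m))
    have c1j := c1 j
    have c2j := c2 j (by omega)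
    rw [← sq_eq_sq₀ (by positivity) (by positivity)]
    push_cast
    rw [show (m : ℝ) - (j + 1) + 1 = m - j by ring]
    simp only [mul_pow, div_pow, one_pow]
    rw [Real.sq_sqrt (by positivity), Real.sq_sqrt (by positivity), Real.sq_sqrt (by positivity),
      hsp2]
    have h2 : ((m - 1).choose j : ℝ) = (m.choose (j + 1) : ℝ) * (j + 1) / m := by
      rw [← c1j]; field_simp
    have h3 : (m.choose (j + 1) : ℝ) = m.choose j * (m - j) / (j + 1) := by
      rw [← c2j]; field_simp
    rw [h2, h3]
    field_simp
    ring
  have := mul_sum_apply_mul_rowEsymm_univ I.B I.g (fun i => I.sum_g i (hF i) hrp.le)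
    (fun i => I.sum_g_sq i (hF i) hr hrp) i (I.sum_g_cube i (hF i) hr hrp) k k'
    (lt_of_le_of_lt (by exact_mod_cast (by omega : _ ≤ _)) hd)
  rw [mul_comm, ← eq_div_iff hp.ne'] at this
  have e : ∑ x, I.g i (I.B.mulVec x i) * (I.realBasis k x * I.realBasis k' x) =
      1 / Real.sqrt ((p : ℝ) ^ n / (p : ℝ) ^ (k : ℕ) * (m.choose k : ℝ)) *
      (1 / Real.sqrt ((p : ℝ) ^ n / (p : ℝ) ^ (k' : ℕ) * (m.choose k' : ℝ))) *
      ∑ x, I.g i (I.B.mulVec x i) *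
        (rowEsymm I.B I.g Finset.univ k x * rowEsymm I.B I.g Finset.univ k' x) := by
    rw [Finset.mul_sum]
    refine Finset.sum_congr rfl fun x _ => ?_
    simp only [realBasis, realBasis_normalization hp]
    change _ = _ * (_ * (I.elemSym k x * I.elemSym k' x))
    ring
  rw [e, this]
  unfold tridiagonal
  by_cases h : k = k'
  · subst h
    simp only [if_true]
    split_ifs with h0
    · simp [h0]
    · obtain ⟨j, hj⟩ := Nat.exists_eq_succ_of_ne_zero h0
      have hjl : j + 1 ≤ l := by have := k.2; omega
      rw [hj, Nat.succ_eq_add_one, Nat.add_sub_cancel]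
      have h1 := hchoose (j + 1) (by omega)
      have c1j := c1 j
      have h2 : ((m - 1).choose j : ℝ) = (m.choose (j + 1) : ℝ) * (j + 1) / m := by
        rw [← c1j]; field_simp
      rw [h2, ← mul_div_mul_comm, Real.mul_self_sqrt (by positivity)]
      push_cast
      field_simp
      ring
  · have h' : (k : ℕ) ≠ k' := fun hh => h (Fin.ext hh)
    simp only [h, h', if_false]
    split_ifs with ha hb
    · rw [← ha]
      exact off k (by omega)
    · rw [← hb, ← off k' (by omega)]
      ring
    · simp

end Expectation

end MaxLinSAT

/-! ### DQI states as polynomials in the objective -/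

/-- If all the power sums `∑ i, y_i ^ j` of a family are polynomials of degree at most `j` in a
quantity, then so are the elementary symmetric functions. -/
theorem exists_polynomial_eval_eq_esymm {ι X : Type*} [Fintype ι] (y : X → ι → ℝ) (f : X → ℝ)
    (hp : ∀ j : ℕ, 0 < j → ∃ Q : ℝ[X], Q.natDegree ≤ j ∧ ∀ x, ∑ i, y x i ^ j = Q.eval (f x))
    (k : ℕ) :
    ∃ Q : ℝ[X], Q.natDegree ≤ k ∧
      ∀ x, ∑ S ∈ (Finset.univ : Finset ι).powersetCard k, ∏ i ∈ S, y x i = Q.eval (f x) := by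
  classical
  choose! R hRdeg hR using hp
  induction k using Nat.strong_induction_on with
  | _ k ih =>
    rcases Nat.eq_zero_or_pos k with rfl | hk
    · exact ⟨1, by simp, by simp⟩
    choose! Q hQdeg hQ using ih
    -- Newton's identity solved for the `k`-th elementary symmetric function; `a.1 < k` keeps the
    -- power-sum index `a.2` positive.
    refine ⟨C ((-1) ^ (k + 1) / (k : ℝ)) *
      ∑ a ∈ Finset.HasAntidiagonal.antidiagonal k with a.1 < k, C ((-1) ^ a.1) * Q a.1 * R a.2, ?_, fun x => ?_⟩
    · refine (natDegree_C_mul_le _ _).trans (natDegree_sum_le_of_forall_le _ _ fun a ha => ?_)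
      rw [Finset.mem_filter, Finset.HasAntidiagonal.mem_antidiagonal] at ha
      rw [← ha.1]
      exact natDegree_mul_le_of_le ((natDegree_C_mul_le _ _).trans (hQdeg _ ha.2))
        (hRdeg _ (by omega))
    · have := congrArg (MvPolynomial.aeval (y x)) (MvPolynomial.mul_esymm_eq_sum ι ℝ k)
      simp only [map_mul, map_sum, map_pow, map_neg, map_one, map_natCast, MvPolynomial.esymm,
        MvPolynomial.psum, map_prod, MvPolynomial.aeval_X] at this
      rw [eval_mul, eval_C, eval_finsetSum, div_mul_eq_mul_div, eq_div_iff (by positivity),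
        mul_comm, this]
      congr 1
      refine Finset.sum_congr rfl fun a ha => ?_
      rw [Finset.mem_filter, Finset.HasAntidiagonal.mem_antidiagonal] at ha
      rw [eval_mul, eval_mul, eval_C, ← hQ _ ha.2, ← hR _ (by omega)]

namespace MaxLinSAT

variable {p m n r : ℕ} [NeZero p] (I : MaxLinSAT p m n)

theorem exists_polynomial_eval_eq_elemSym (hF : ∀ i, (I.F i).card = r) (hrp : r ≤ p) (k : ℕ) :
    ∃ Q : ℝ[X], Q.natDegree ≤ k ∧ ∀ x, I.elemSym k x = Q.eval (I.objective x) := by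
  refine exists_polynomial_eval_eq_esymm (fun x i => I.g i (I.B.mulVec x i)) I.objective
    (fun j hj => ?_) k
  set φ : ℝ → ℝ := fun y => ((y - (2 * r - p) / p) / (2 * Real.sqrt (r * (p - r) / p))) ^ j with hφ
  -- Since `f_i = ±1`, `g_i ^ j` is the affine interpolant of `φ` at `±1`. As all `|F_i| = r`, `φ`
  -- does not depend on `i`, and the sum over `i` is affine in `f`.
  refine ⟨C ((φ 1 - φ (-1)) / 2) * X + C (m * ((φ 1 + φ (-1)) / 2)), ?_, fun x => ?_⟩
  · exact natDegree_linear_le.trans hj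
  · have : ∀ i, I.g i (I.B.mulVec x i) ^ j =
        (φ 1 - φ (-1)) / 2 * I.f i (I.B.mulVec x i) + (φ 1 + φ (-1)) / 2 := by
      intro i
      have : I.g i (I.B.mulVec x i) ^ j = φ (I.f i (I.B.mulVec x i)) := by
        rw [g, I.fMean_eq i (hF i) hrp, I.phi_eq i (hF i) hrp]
      rw [this, f]
      split_ifs <;> ring
    simp only [this, Finset.sum_add_distrib, ← Finset.mul_sum]
    simp [objective]

/-- Every DQI state comes from a polynomial. -/
theorem exists_polyState_eq_dqiState (hF : ∀ i, (I.F i).card = r) (hrp : r ≤ p) {l : ℕ}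
    (w : EuclideanSpace ℂ (Fin (l + 1))) :
    ∃ P : ℂ[X], P.natDegree ≤ l ∧ I.polyState P = I.dqiState w := by
  choose Q hdeg hQ using fun k => I.exists_polynomial_eval_eq_elemSym hF hrp k
  refine ⟨∑ k : Fin (l + 1), C (w k * ((1 / Real.sqrt ((p : ℝ) ^ ((n : ℤ) - ((k : ℕ) : ℤ)) *
    (m.choose k : ℝ)) : ℝ) : ℂ)) * (Q k).map Complex.ofRealHom, ?_, ?_⟩
  · refine natDegree_sum_le_of_forall_le _ _ fun k _ => (natDegree_C_mul_le _ _).trans ?_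
    exact natDegree_map_le.trans ((hdeg k).trans (Nat.le_of_lt_succ k.2))
  · funext x
    rw [polyState, dqiState, eval_finsetSum]
    refine Finset.sum_congr rfl fun k _ => ?_
    rw [eval_mul, eval_C, basisState, hQ, Complex.ofReal_mul, mul_assoc]
    congr 2
    exact eval_map_apply Complex.ofRealHom (I.objective x)

end MaxLinSAT

/-! ### Largest eigenvalues of symmetric matrices -/

open Matrix in
/-- `lam` is an eigenvalue of `A` and an upper bound of its numerical range. -/
def IsTopEigenvalue {ι : Type*} [Fintype ι] (A : Matrix ι ι ℝ) (lam : ℝ) : Prop :=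
  (∀ x, x ⬝ᵥ A *ᵥ x ≤ lam * (x ⬝ᵥ x)) ∧ ∃ u, u ⬝ᵥ u = 1 ∧ A *ᵥ u = lam • u

-- The Rayleigh quotient attains its maximum on the compact unit sphere, and a maximizer for a
-- self-adjoint operator is an eigenvector.
open Matrix in
theorem exists_isTopEigenvalue {ι : Type*} [Fintype ι] [Nonempty ι] (A : Matrix ι ι ℝ)
    (hA : A.IsSymm) : ∃ lam, IsTopEigenvalue A lam := by
  classical
  set T := Matrix.toEuclideanCLM (n := ι) (𝕜 := ℝ) A with hT
  have hTsa : IsSelfAdjoint T := by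
    have : IsSelfAdjoint A := by
      rw [IsSelfAdjoint, Matrix.star_eq_conjTranspose, Matrix.conjTranspose_eq_transpose_of_trivial]
      exact hA
    exact this.map _
  have hq : ∀ x : EuclideanSpace ℝ ι, T.reApplyInnerSelf x = x.ofLp ⬝ᵥ A *ᵥ x.ofLp := fun x => by
    simp [ContinuousLinearMap.reApplyInnerSelf_apply, PiLp.inner_apply, hT, dotProduct, mul_comm]
  have hn : ∀ x : EuclideanSpace ℝ ι, ‖x‖ ^ 2 = x.ofLp ⬝ᵥ x.ofLp := fun x => by
    rw [EuclideanSpace.norm_sq_eq]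
    simp [dotProduct, sq]
  obtain ⟨x₀, hx₀, hmax⟩ := (isCompact_sphere (0 : EuclideanSpace ℝ ι) 1).exists_isMaxOn
    (NormedSpace.sphere_nonempty.mpr zero_le_one) T.reApplyInnerSelf_continuous.continuousOn
  have hx₀n : ‖x₀‖ = 1 := by simpa using hx₀
  have hx₀0 : x₀ ≠ 0 := by rintro rfl; simp at hx₀n
  obtain ⟨lam, hlam⟩ : ∃ lam : ℝ, T x₀ = lam • x₀ :=
    ⟨_, (hTsa.hasEigenvector_of_isMaxOn hx₀0 (by rwa [hx₀n])).apply_eq_smul⟩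
  have hu : x₀.ofLp ⬝ᵥ x₀.ofLp = 1 := by rw [← hn, hx₀n, one_pow]
  have hAu : A *ᵥ x₀.ofLp = lam • x₀.ofLp := by
    have := congrArg WithLp.ofLp hlam
    simpa [hT] using this
  refine ⟨lam, fun x => ?_, x₀.ofLp, hu, hAu⟩
  rcases eq_or_ne (WithLp.toLp 2 x) 0 with h0 | h0
  · have : x = 0 := by simpa using h0
    simp [this]
  · set y := WithLp.toLp 2 x with hy
    have hyn : 0 < ‖y‖ := norm_pos_iff.mpr h0
    have h1 := hmax (show (‖y‖⁻¹ : ℝ) • y ∈ Metric.sphere (0 : EuclideanSpace ℝ ι) 1 by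
      simp [norm_smul, hyn.ne'])
    simp only [Set.mem_ofPred_eq] at h1
    rw [hq x₀, hAu, dotProduct_smul, hu, T.reApplyInnerSelf_smul, hq y] at h1
    have h2 := hn y
    simp only [norm_inv, norm_norm, smul_eq_mul, mul_one] at h1
    rw [← h2]
    rw [inv_pow, inv_mul_le_iff₀ (by positivity)] at h1
    linarith

open Matrix in
theorem IsTopEigenvalue.isGreatest {ι : Type*} [Fintype ι] [DecidableEq ι] {A : Matrix ι ι ℝ}
    {lam : ℝ} (h : IsTopEigenvalue A lam) :
    IsGreatest {x : ℝ | Module.End.HasEigenvalue (Matrix.toLin' A) x} lam := by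
  obtain ⟨hle, u, hu, hAu⟩ := h
  constructor
  · refine Module.End.hasEigenvalue_of_hasEigenvector (x := u) ?_
    rw [Module.End.hasEigenvector_iff, Module.End.mem_eigenspace_iff, Matrix.toLin'_apply]
    exact ⟨hAu, by rintro rfl; simp at hu⟩
  · intro x hx
    obtain ⟨v, hv⟩ := hx.exists_hasEigenvector
    have h1 := hle v
    have h2 := hv.apply_eq_smul
    rw [Matrix.toLin'_apply] at h2
    rw [h2, dotProduct_smul, smul_eq_mul] at h1
    refine le_of_mul_le_mul_right h1 ?_
    have := dotProduct_self_star_pos_iff.mpr hv.2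
    rwa [star_trivial] at this

/-! ### Asymptotics of the top eigenvalue of the tridiagonal matrix -/

section Tridiagonal

open Matrix

theorem tridiagonal_isSymm (m l : ℕ) (d : ℝ) : (tridiagonal m l d).IsSymm := by
  refine Matrix.IsSymm.ext fun i j => ?_
  unfold tridiagonal
  by_cases h : i = j
  · subst h; rfl
  · by_cases h1 : (i : ℕ) + 1 = j
    · have h2 : ¬ (j : ℕ) + 1 = i := by omega
      simp [h, Ne.symm h, h1, h2]
    · simp [h, Ne.symm h, h1]

theorem dotProduct_tridiagonal_mulVec (m l : ℕ) (d : ℝ) (x : Fin (l + 1) → ℝ) :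
    x ⬝ᵥ tridiagonal m l d *ᵥ x = ∑ k : Fin (l + 1), (k : ℝ) * d * x k ^ 2 +
      2 * ∑ k : Fin l, Real.sqrt (((k : ℕ) + 1 : ℝ) * (m - (k : ℕ))) *
        (x k.castSucc * x k.succ) := by
  set a : Fin (l + 1) → ℝ := fun j => Real.sqrt ((j : ℝ) * ((m : ℝ) - (j : ℝ) + 1)) with ha
  have hA : ∀ i j, tridiagonal m l d i j = (if i = j then (i : ℝ) * d else 0) +
      ((if (i : ℕ) + 1 = j then a j else 0) + (if (j : ℕ) + 1 = i then a i else 0)) := by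
    intro i j
    unfold tridiagonal
    by_cases h : i = j
    · subst h; simp
    · by_cases h1 : (i : ℕ) + 1 = j
      · have h2 : ¬ (j : ℕ) + 1 = i := by omega
        simp [h, h1, h2, ha]
      · simp [h, h1, ha]
  have hup : ∑ i : Fin (l + 1), ∑ j : Fin (l + 1), x i * ((if (i : ℕ) + 1 = j then a j else 0) * x j) =
      ∑ k : Fin l, Real.sqrt (((k : ℕ) + 1 : ℝ) * (m - (k : ℕ))) * (x k.castSucc * x k.succ) := by
    rw [Fin.sum_univ_castSucc]
    have hlast : ∑ j : Fin (l + 1), x (Fin.last l) *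
        ((if ((Fin.last l : Fin (l + 1)) : ℕ) + 1 = j then a j else 0) * x j) = 0 := by
      refine Finset.sum_eq_zero fun j _ => ?_
      have := j.2
      rw [if_neg (by rw [Fin.val_last]; omega)]
      ring
    rw [hlast, add_zero]
    refine Finset.sum_congr rfl fun k _ => ?_
    rw [Finset.sum_eq_single k.succ]
    · simp only [Fin.val_castSucc, Fin.val_succ, if_true, ha]
      push_cast
      rw [show (m : ℝ) - ((k : ℕ) + 1) + 1 = m - (k : ℕ) by ring]
      ring
    · intro j _ hj
      rw [if_neg]
      · ring
      · intro h
        exact hj (Fin.ext (by simpa using h.symm))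
    · simp
  have hlow : ∑ i : Fin (l + 1), ∑ j : Fin (l + 1), x i * ((if (j : ℕ) + 1 = i then a i else 0) * x j) =
      ∑ i : Fin (l + 1), ∑ j : Fin (l + 1), x i * ((if (i : ℕ) + 1 = j then a j else 0) * x j) := by
    rw [Finset.sum_comm]
    exact Finset.sum_congr rfl fun i _ => Finset.sum_congr rfl fun j _ => by ring
  have hdiag : ∑ i : Fin (l + 1), ∑ j : Fin (l + 1), x i * ((if i = j then (i : ℝ) * d else 0) * x j)
      = ∑ k : Fin (l + 1), (k : ℝ) * d * x k ^ 2 := by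
    refine Finset.sum_congr rfl fun i _ => ?_
    simp
    ring
  have hsplit : x ⬝ᵥ tridiagonal m l d *ᵥ x =
      ∑ i : Fin (l + 1), ∑ j : Fin (l + 1), x i * ((if i = j then (i : ℝ) * d else 0) * x j) +
      (∑ i : Fin (l + 1), ∑ j : Fin (l + 1), x i * ((if (i : ℕ) + 1 = j then a j else 0) * x j) +
      ∑ i : Fin (l + 1), ∑ j : Fin (l + 1), x i * ((if (j : ℕ) + 1 = i then a i else 0) * x j)) := by
    simp only [dotProduct, mulVec, Finset.mul_sum, hA, ← Finset.sum_add_distrib]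
    exact Finset.sum_congr rfl fun i _ => Finset.sum_congr rfl fun j _ => by ring
  rw [hsplit, hdiag, hlow, hup, two_mul]

/-- The Gershgorin bound. -/
theorem IsTopEigenvalue.tridiagonal_le {m l : ℕ} {d lam U : ℝ}
    (h : IsTopEigenvalue (tridiagonal m l d) lam)
    (hU : ∀ k ≤ l, (k : ℝ) * d + Real.sqrt (k * (m - k + 1)) +
      Real.sqrt ((k + 1) * (m - k)) ≤ U) : lam ≤ U := by
  obtain ⟨-, x, hx, hAx⟩ := h
  have hlam : lam = x ⬝ᵥ tridiagonal m l d *ᵥ x := by simp [hAx, hx]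
  -- From `2xy ≤ x² + y²` on neighbouring coordinates. At the borders, the extra term at `k = l` is
  -- nonnegative and the one at `k = 0` vanishes.
  have h1 : 2 * ∑ k : Fin l, Real.sqrt (((k : ℕ) + 1 : ℝ) * (m - (k : ℕ))) *
        (x k.castSucc * x k.succ) ≤
      ∑ k : Fin (l + 1), Real.sqrt (((k : ℕ) + 1 : ℝ) * (m - (k : ℕ))) * x k ^ 2 +
      ∑ k : Fin (l + 1), Real.sqrt ((k : ℕ) * (m - (k : ℕ) + 1)) * x k ^ 2 := by
    rw [Fin.sum_univ_castSucc (n := l), Fin.sum_univ_succ (n := l)]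
    have h2 : 2 * ∑ k : Fin l, Real.sqrt (((k : ℕ) + 1 : ℝ) * (m - (k : ℕ))) *
        (x k.castSucc * x k.succ) ≤
        ∑ k : Fin l, Real.sqrt (((k : ℕ) + 1 : ℝ) * (m - (k : ℕ))) * x k.castSucc ^ 2 +
        ∑ k : Fin l, Real.sqrt (((k : ℕ) + 1 : ℝ) * (m - (k : ℕ))) * x k.succ ^ 2 := by
      rw [Finset.mul_sum, ← Finset.sum_add_distrib]
      refine Finset.sum_le_sum fun k _ => ?_
      have := mul_nonneg (Real.sqrt_nonneg (((k : ℕ) + 1 : ℝ) * (m - (k : ℕ))))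
        (sq_nonneg (x k.castSucc - x k.succ))
      linarith
    have h3 : ∑ k : Fin l, Real.sqrt (((k : ℕ) + 1 : ℝ) * (m - (k : ℕ))) * x k.succ ^ 2 =
        ∑ k : Fin l, Real.sqrt (((k.succ : Fin (l + 1)) : ℕ) * (m - ((k.succ : Fin (l + 1)) : ℕ) + 1))
          * x k.succ ^ 2 := by
      refine Finset.sum_congr rfl fun k _ => ?_
      rw [Fin.val_succ]
      push_cast
      rw [show (m : ℝ) - ((k : ℕ) + 1) + 1 = m - (k : ℕ) by ring]
    rw [h3] at h2
    have h4 := mul_nonneg (Real.sqrt_nonneg ((((Fin.last l : Fin (l + 1)) : ℕ) + 1 : ℝ) *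
      (m - ((Fin.last l : Fin (l + 1)) : ℕ)))) (sq_nonneg (x (Fin.last l)))
    simp only [Fin.val_castSucc, Fin.val_zero, Nat.cast_zero, zero_mul, Real.sqrt_zero, zero_add]
    linarith
  rw [hlam, dotProduct_tridiagonal_mulVec]
  calc _ ≤ ∑ k : Fin (l + 1), U * x k ^ 2 := by
        refine (add_le_add_right h1 _).trans ?_
        rw [← Finset.sum_add_distrib, ← Finset.sum_add_distrib]
        refine Finset.sum_le_sum fun k _ => ?_
        have := mul_le_mul_of_nonneg_right (hU k (Nat.le_of_lt_succ k.2)) (sq_nonneg (x k))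
        linarith
    _ = U := by
        rw [← Finset.mul_sum]
        have : ∑ k, x k ^ 2 = 1 := by rw [← hx]; simp [dotProduct, sq]
        rw [this, mul_one]

/-- The lower bound from the indicator function of the last `L` coordinates. -/
theorem IsTopEigenvalue.le_tridiagonal {m l L : ℕ} {d lam : ℝ}
    (h : IsTopEigenvalue (tridiagonal m l d) lam) (hL : 1 ≤ L) (hLl : L ≤ l) (hlm : l ≤ m) :
    L * (l * d - L * |d|) + 2 * (L - 1) * Real.sqrt ((l - L) * (m - l)) ≤ lam * L := by
  have hLl' : (L : ℝ) ≤ l := by exact_mod_cast hLl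
  have hlm' : (l : ℝ) ≤ m := by exact_mod_cast hlm
  set x : Fin (l + 1) → ℝ := fun k => if l < k + L then 1 else 0 with hx
  have hsq : ∀ k, x k ^ 2 = x k := fun k => by simp only [hx]; split_ifs <;> norm_num
  have hsum : ∑ k, x k = L := by
    have h1 := Fin.sum_univ_eq_sum_range (fun k => if l < k + L then (1 : ℝ) else 0) (l + 1)
    rw [hx, h1, ← Finset.sum_filter, Finset.sum_const, nsmul_one]
    congr 1
    have : (Finset.range (l + 1)).filter (fun k => l < k + L) = Finset.Ico (l + 1 - L) (l + 1) := by
      ext k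
      simp only [Finset.mem_filter, Finset.mem_range, Finset.mem_Ico]
      omega
    rw [this, Nat.card_Ico]
    omega
  have hxx : x ⬝ᵥ x = L := by
    rw [← hsum]
    exact Finset.sum_congr rfl fun k _ => by rw [← sq, hsq]
  have hprod : ∀ k : Fin l, x k.castSucc * x k.succ = x k.castSucc := fun k => by
    simp only [hx, Fin.val_castSucc, Fin.val_succ]
    by_cases h1 : l < (k : ℕ) + L
    · simp [h1, show l < (k : ℕ) + 1 + L by omega]
    · simp [h1]
  have hsum' : ∑ k : Fin l, x k.castSucc = L - 1 := by
    rw [Fin.sum_univ_castSucc] at hsum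
    have : x (Fin.last l) = 1 := by
      simp only [hx, Fin.val_last]
      rw [if_pos (by omega)]
    linarith
  have h1 := h.1 x
  rw [hxx, dotProduct_tridiagonal_mulVec] at h1
  -- The trial vector has `L` ones, hence `L - 1` neighbouring pairs. On its support `l - L ≤ k ≤
  -- l`, which bounds the diagonal and off-diagonal entries separately.
  refine le_trans (add_le_add ?_ ?_) h1
  · rw [← hsum, mul_comm (∑ k, x k), Finset.mul_sum, hsum]
    refine Finset.sum_le_sum fun k _ => ?_
    rw [hsq]
    simp only [hx]
    split_ifs with hk
    · have hk' : (l : ℝ) ≤ k + L := by exact_mod_cast hk.le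
      have hkl : ((k : ℕ) : ℝ) ≤ l := by exact_mod_cast Nat.le_of_lt_succ k.2
      have := le_abs_self d
      have : ((l : ℝ) - k) * d ≤ L * |d| :=
        (mul_le_mul_of_nonneg_left this (by linarith)).trans
          (mul_le_mul_of_nonneg_right (by linarith) (abs_nonneg d))
      linarith
    · simp
  · rw [mul_assoc]
    refine mul_le_mul_of_nonneg_left ?_ zero_le_two
    rw [← hsum', Finset.sum_mul]
    refine Finset.sum_le_sum fun k _ => ?_
    rw [hprod, mul_comm]
    simp only [hx, Fin.val_castSucc]
    split_ifs with hk
    · have hk' : (l : ℝ) ≤ k + L := by exact_mod_cast hk.le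
      have hkl : ((k : ℕ) : ℝ) ≤ l := by exact_mod_cast k.2.le
      rw [mul_one, mul_one]
      refine Real.sqrt_le_sqrt (mul_le_mul ?_ ?_ ?_ ?_) <;> linarith
    · simp

end Tridiagonal

theorem sqrt_add_le_add_sqrt {x y : ℝ} (hx : 0 ≤ x) (hy : 0 ≤ y) :
    Real.sqrt (x + y) ≤ Real.sqrt x + Real.sqrt y := by
  rw [Real.sqrt_le_left (by positivity), add_sq, Real.sq_sqrt hx, Real.sq_sqrt hy]
  have := mul_nonneg (Real.sqrt_nonneg x) (Real.sqrt_nonneg y)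
  linarith

/-- The upper bound for the largest eigenvalue, when `x d + 2 √(x (1 - x))` is maximal on `[0, μ]`
at `μ`. -/
theorem IsTopEigenvalue.tridiagonal_le_add_sqrt {m l : ℕ} {d lam μ : ℝ}
    (h : IsTopEigenvalue (tridiagonal m l d) lam) (hlm : l < m) (hμ : (l : ℝ) / m = μ)
    (hmono : ∀ x, 0 ≤ x → x ≤ μ →
      x * d + 2 * Real.sqrt (x * (1 - x)) ≤ μ * d + 2 * Real.sqrt (μ * (1 - μ))) :
    lam ≤ m * (μ * d + 2 * Real.sqrt (μ * (1 - μ))) + 2 * Real.sqrt m := by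
  have hm : (0 : ℝ) < m := by exact_mod_cast (Nat.zero_le l).trans_lt hlm
  refine h.tridiagonal_le fun k hk => ?_
  have hkl : (k : ℝ) ≤ l := by exact_mod_cast hk
  have hkm : (k : ℝ) ≤ m := by exact_mod_cast hk.trans hlm.le
  have hk0 : (0 : ℝ) ≤ k := Nat.cast_nonneg k
  have hprod : 0 ≤ (k : ℝ) * (m - k) := mul_nonneg hk0 (by linarith)
  have h1 := hmono (k / m) (by positivity) (by rw [← hμ]; gcongr)
  have h2 : m * Real.sqrt (k / m * (1 - k / m)) = Real.sqrt (k * (m - k)) := by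
    rw [show (k : ℝ) * (m - k) = m ^ 2 * (k / m * (1 - k / m)) by field_simp,
      Real.sqrt_mul (sq_nonneg (m : ℝ)), Real.sqrt_sq hm.le]
  have h3 := mul_le_mul_of_nonneg_left h1 hm.le
  have h4 : (m : ℝ) * (k / m * d + 2 * Real.sqrt (k / m * (1 - k / m))) =
      k * d + 2 * Real.sqrt (k * (m - k)) := by
    rw [← h2]; field_simp
  rw [h4] at h3
  -- Replacing each of the two off-diagonal entries by `√(k(m-k))` costs at most `√m`, negligible
  -- after division by `m`.
  have h5 : Real.sqrt (k * (m - k + 1)) ≤ Real.sqrt (k * (m - k)) + Real.sqrt m := by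
    rw [mul_add, mul_one]
    exact (sqrt_add_le_add_sqrt hprod hk0).trans
      (add_le_add_right (Real.sqrt_le_sqrt hkm) _)
  have h6 : Real.sqrt ((k + 1) * (m - k)) ≤ Real.sqrt (k * (m - k)) + Real.sqrt m := by
    rw [add_mul, one_mul]
    exact (sqrt_add_le_add_sqrt hprod (by linarith)).trans
      (add_le_add_right (Real.sqrt_le_sqrt (by linarith)) _)
  linarith

theorem tendsto_topEigenvalue_div {m l : ℕ → ℕ} {lam : ℕ → ℝ} {d μ : ℝ}
    (hm : Tendsto m atTop atTop) (hl : Tendsto l atTop atTop) (hlt : ∀ N, l N < m N)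
    (hlm : ∀ N, (l N : ℝ) / (m N : ℝ) = μ)
    (hlam : ∀ N, IsTopEigenvalue (tridiagonal (m N) (l N) d) (lam N))
    (hmono : ∀ x, 0 ≤ x → x ≤ μ →
      x * d + 2 * Real.sqrt (x * (1 - x)) ≤ μ * d + 2 * Real.sqrt (μ * (1 - μ))) :
    Tendsto (fun N => lam N / (m N : ℝ)) atTop (𝓝 (μ * d + 2 * Real.sqrt (μ * (1 - μ)))) := by
  have hmpos : ∀ N, (0 : ℝ) < m N := fun N => by exact_mod_cast (Nat.zero_le _).trans_lt (hlt N)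
  have hmR : Tendsto (fun N => Real.sqrt (m N : ℝ)) atTop atTop :=
    Real.tendsto_sqrt_atTop.comp (tendsto_natCast_atTop_atTop.comp hm)
  -- A block of length about `√l` is long enough for `1/L → 0` and short enough for `L/m → 0`.
  set L : ℕ → ℕ := fun N => Nat.sqrt (l N) with hL
  have hLtop : Tendsto L atTop atTop := by
    refine tendsto_atTop.mpr fun b => ?_
    filter_upwards [hl.eventually_ge_atTop (b * b)] with N hN
    exact Nat.le_sqrt.mpr hN
  have hLinv : Tendsto (fun N => ((L N : ℝ))⁻¹) atTop (𝓝 0) :=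
    tendsto_inv_atTop_zero.comp (tendsto_natCast_atTop_atTop.comp hLtop)
  have hLm : Tendsto (fun N => (L N : ℝ) / m N) atTop (𝓝 0) := by
    refine squeeze_zero' (Eventually.of_forall fun N => by positivity) ?_ hLinv
    filter_upwards [hLtop.eventually_ge_atTop 1] with N hN
    have hLp : (0 : ℝ) < L N := by exact_mod_cast hN
    rw [div_le_iff₀ (hmpos N), inv_mul_eq_div, le_div_iff₀ hLp]
    exact_mod_cast (Nat.sqrt_le (l N)).trans (hlt N).le
  have hlow : Tendsto (fun N => μ * d - (L N : ℝ) / m N * |d| +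
      2 * (1 - (L N : ℝ)⁻¹) * Real.sqrt ((μ - (L N : ℝ) / m N) * (1 - μ))) atTop
      (𝓝 (μ * d + 2 * Real.sqrt (μ * (1 - μ)))) := by
    have h1 := ((hLm.const_sub μ).mul_const (1 - μ)).sqrt
    have h2 := ((hLinv.const_sub 1).const_mul 2).mul h1
    have h3 := ((hLm.mul_const |d|).const_sub (μ * d)).add h2
    simpa using h3
  have hup : Tendsto (fun N => μ * d + 2 * Real.sqrt (μ * (1 - μ)) + 2 * (Real.sqrt (m N : ℝ))⁻¹)
      atTop (𝓝 (μ * d + 2 * Real.sqrt (μ * (1 - μ)))) := by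
    simpa using ((tendsto_inv_atTop_zero.comp hmR).const_mul 2).const_add
      (μ * d + 2 * Real.sqrt (μ * (1 - μ)))
  refine tendsto_of_tendsto_of_tendsto_of_le_of_le' hlow hup ?_ (Eventually.of_forall fun N => ?_)
  · filter_upwards [hLtop.eventually_ge_atTop 1] with N hN
    have hLp : (0 : ℝ) < L N := by exact_mod_cast hN
    have hmN := hmpos N
    have h1 := (hlam N).le_tridiagonal hN (Nat.sqrt_le_self _) (hlt N).le
    have hlN : (l N : ℝ) = μ * m N := by rw [← hlm N]; field_simp
    have h2 : Real.sqrt (((l N : ℝ) - L N) * (m N - l N)) =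
        m N * Real.sqrt ((μ - (L N : ℝ) / m N) * (1 - μ)) := by
      rw [hlN, show (μ * m N - L N : ℝ) * (m N - μ * m N) =
        (m N : ℝ) ^ 2 * ((μ - (L N : ℝ) / m N) * (1 - μ)) by field_simp,
        Real.sqrt_mul (sq_nonneg (m N : ℝ)), Real.sqrt_sq hmN.le]
    rw [h2, hlN] at h1
    rw [le_div_iff₀ hmN]
    refine le_of_mul_le_mul_right (le_trans (le_of_eq ?_) h1) hLp
    field_simp
  · have h1 := (hlam N).tridiagonal_le_add_sqrt (hlt N) (hlm N) hmono
    have hmN := hmpos N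
    have hs := Real.sqrt_pos.mpr hmN
    rw [div_le_iff₀ hmN]
    refine h1.trans (le_of_eq ?_)
    have h2 : (Real.sqrt (m N : ℝ))⁻¹ * m N = Real.sqrt (m N) := by
      rw [inv_mul_eq_div, Real.div_sqrt]
    rw [add_mul, mul_assoc 2, h2]
    ring

/-! ### Monotonicity of the bracket -/

/-- The bracket is nondecreasing on `[0, 1 - q]`. -/
theorem bracket_le_bracket {q x y : ℝ} (hq0 : 0 ≤ q) (hq1 : q ≤ 1) (hx : 0 ≤ x) (hxy : x ≤ y)
    (hy : y ≤ 1 - q) : bracket q x ≤ bracket q y := by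
  -- With `z = sin² α` and `q = sin² θ` the square is `sin² (α + θ)`, and `z ≤ 1 - q` says `α + θ ≤
  -- π/2`.
  have expand : ∀ z, 0 ≤ z → z ≤ 1 - q → bracket q z =
      (Real.sqrt z * Real.sqrt (1 - q) + Real.sqrt (1 - z) * Real.sqrt q) ^ 2 - q := by
    intro z hz hz1
    rw [add_sq, mul_pow, mul_pow, Real.sq_sqrt hz, Real.sq_sqrt (by linarith),
      Real.sq_sqrt (by linarith), Real.sq_sqrt hq0, bracket, Real.sqrt_mul hq0, Real.sqrt_mul hz]
    ring
  rw [expand x hx (hxy.trans hy), expand y (hx.trans hxy) hy]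
  refine sub_le_sub_right (pow_le_pow_left₀ (by positivity) ?_ 2) q
  have hx2 := Real.sq_sqrt hx
  have hy2 := Real.sq_sqrt (hx.trans hxy)
  have hx2' := Real.sq_sqrt (show 0 ≤ 1 - x by linarith)
  have hy2' := Real.sq_sqrt (show 0 ≤ 1 - y by linarith)
  have a1 : Real.sqrt x ≤ Real.sqrt (1 - q) := Real.sqrt_le_sqrt (hxy.trans hy)
  have a2 : Real.sqrt y ≤ Real.sqrt (1 - q) := Real.sqrt_le_sqrt hy
  have a3 : Real.sqrt q ≤ Real.sqrt (1 - x) := Real.sqrt_le_sqrt (by linarith)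
  have a4 : Real.sqrt q ≤ Real.sqrt (1 - y) := Real.sqrt_le_sqrt (by linarith)
  have a5 : Real.sqrt x ≤ Real.sqrt y := Real.sqrt_le_sqrt hxy
  have a6 : Real.sqrt (1 - y) ≤ Real.sqrt (1 - x) := Real.sqrt_le_sqrt (by linarith)
  have b1 := Real.sqrt_nonneg x
  have b2 := Real.sqrt_nonneg q
  generalize Real.sqrt x = s at *
  generalize Real.sqrt y = t at *
  generalize Real.sqrt (1 - x) = s' at *
  generalize Real.sqrt (1 - y) = t' at *
  generalize Real.sqrt (1 - q) = c at *
  generalize Real.sqrt q = e at *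
  -- Both `s² + s'²` and `t² + t'²` equal 1. Combined with `e (t + s) ≤ 2ec ≤ c (s' + t')`, this
  -- shows that the gain `(t - s) c` outweighs the loss `(s' - t') e`.
  have key : (t - s) * (t + s) = (s' - t') * (s' + t') := by nlinarith
  rcases eq_or_lt_of_le (show 0 ≤ t + s by linarith) with h0 | h0
  · have hs : s = 0 := by linarith
    have ht : t = 0 := by linarith
    subst hs ht
    have : s' = t' := by
      have h1 : s' ^ 2 = t' ^ 2 := by linarith
      exact (sq_eq_sq₀ (by linarith) (by linarith)).mp h1
    rw [this]
  · refine le_of_mul_le_mul_right ?_ h0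
    have h1 : (s' - t') * e * (t + s) ≤ (s' - t') * c * (s' + t') := by
      rw [mul_assoc, mul_assoc]
      refine mul_le_mul_of_nonneg_left ?_ (by linarith)
      nlinarith
    nlinarith

/-! ### Real symmetric forms at complex coefficient vectors -/

section ComplexQuadraticForm

open Matrix

/-- The quadratic form `w† A w` of a real matrix at a complex vector. -/
noncomputable def complexQuadForm {l : ℕ} (A : Matrix (Fin l) (Fin l) ℝ)
    (w : EuclideanSpace ℂ (Fin l)) : ℝ :=
  (fun k => (w k).re) ⬝ᵥ A *ᵥ (fun k => (w k).re) + (fun k => (w k).im) ⬝ᵥ A *ᵥ (fun k => (w k).im)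

theorem norm_sq_eq_dotProduct_re_add_im {l : ℕ} (w : EuclideanSpace ℂ (Fin l)) :
    ‖w‖ ^ 2 = (fun k => (w k).re) ⬝ᵥ (fun k => (w k).re) +
      (fun k => (w k).im) ⬝ᵥ (fun k => (w k).im) := by
  rw [EuclideanSpace.norm_sq_eq]
  simp only [dotProduct, ← Finset.sum_add_distrib, Complex.sq_norm, Complex.normSq_apply]

theorem complexQuadForm_eq_sum {l : ℕ} (A : Matrix (Fin l) (Fin l) ℝ)
    (w : EuclideanSpace ℂ (Fin l)) :
    complexQuadForm A w =
      ∑ k, ∑ k', ((w k).re * (w k').re + (w k).im * (w k').im) * A k k' := by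
  simp only [complexQuadForm, dotProduct, mulVec, Finset.mul_sum, ← Finset.sum_add_distrib]
  exact Finset.sum_congr rfl fun k _ => Finset.sum_congr rfl fun k' _ => by ring

theorem IsTopEigenvalue.complexQuadForm_le {l : ℕ} {A : Matrix (Fin l) (Fin l) ℝ} {lam : ℝ}
    (h : IsTopEigenvalue A lam) {w : EuclideanSpace ℂ (Fin l)} (hw : ‖w‖ = 1) :
    complexQuadForm A w ≤ lam := by
  have h1 := norm_sq_eq_dotProduct_re_add_im w
  rw [hw, one_pow] at h1
  have h2 := add_le_add (h.1 fun k => (w k).re) (h.1 fun k => (w k).im)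
  rwa [← mul_add, ← h1, mul_one] at h2

theorem IsTopEigenvalue.complexQuadForm_eq {l : ℕ} {A : Matrix (Fin l) (Fin l) ℝ} {lam : ℝ}
    (h : IsTopEigenvalue A lam) {w : EuclideanSpace ℂ (Fin l)} (hw : IsPrincipalEigenvector A w) :
    complexQuadForm A w = lam := by
  obtain ⟨hn, lam', hgr, heq⟩ := hw
  obtain rfl := hgr.unique h.isGreatest
  have h1 := norm_sq_eq_dotProduct_re_add_im w
  rw [hn, one_pow] at h1
  have hre : A *ᵥ (fun k => (w k).re) = lam' • fun k => (w k).re := by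
    funext i
    have := congrArg Complex.re (heq i)
    simpa [mulVec, dotProduct] using this
  have him : A *ᵥ (fun k => (w k).im) = lam' • fun k => (w k).im := by
    funext i
    have := congrArg Complex.im (heq i)
    simpa [mulVec, dotProduct] using this
  rw [complexQuadForm, hre, him, dotProduct_smul, dotProduct_smul, ← smul_add, ← h1, smul_eq_mul,
    mul_one]

theorem IsTopEigenvalue.exists_isPrincipalEigenvector {l : ℕ} {A : Matrix (Fin l) (Fin l) ℝ}
    {lam : ℝ} (h : IsTopEigenvalue A lam) : ∃ w, IsPrincipalEigenvector A w := by
  obtain ⟨-, u, hu, hAu⟩ := id h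
  refine ⟨WithLp.toLp 2 fun k => (u k : ℂ), ?_, lam, h.isGreatest, fun i => ?_⟩
  · have h1 := norm_sq_eq_dotProduct_re_add_im (WithLp.toLp 2 fun k => (u k : ℂ))
    simp only [Complex.ofReal_re, Complex.ofReal_im] at h1
    rw [show (fun k => u k) ⬝ᵥ (fun k => u k) = 1 from hu] at h1
    exact (sq_eq_sq₀ (norm_nonneg _) zero_le_one).mp (by rw [h1]; simp [dotProduct])
  · have := congrFun hAu i
    simp only [mulVec, dotProduct, Pi.smul_apply, smul_eq_mul] at this
    simp only
    exact_mod_cast this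

/-- The functions `b k` and `h` are real, so only the real parts of `conj (w k) * w k'` survive. -/
theorem sum_normSq_sum_mul {X : Type*} [Fintype X] {l : ℕ} (w : EuclideanSpace ℂ (Fin l))
    (b : Fin l → X → ℝ) (h : X → ℝ) :
    ∑ x, Complex.normSq (∑ k, w k * (b k x : ℂ)) * h x =
      ∑ k, ∑ k', ((w k).re * (w k').re + (w k).im * (w k').im) *
        ∑ x, h x * (b k x * b k' x) := by
  simp only [Finset.mul_sum]
  rw [Finset.sum_congr rfl fun k _ => Finset.sum_comm, Finset.sum_comm]
  refine Finset.sum_congr rfl fun x _ => ?_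
  rw [Complex.normSq_apply]
  simp only [Complex.re_sum, Complex.im_sum, Complex.re_mul_ofReal, Complex.im_mul_ofReal,
    Finset.sum_mul_sum, ← Finset.sum_add_distrib]
  simp only [Finset.sum_mul]
  exact Finset.sum_congr rfl fun k _ => Finset.sum_congr rfl fun k' _ => by ring

end ComplexQuadraticForm

/-! ### The optimum in terms of the top eigenvalue -/

theorem tau1_nonneg {p m n : ℕ} (B : Matrix (Fin m) (Fin n) (ZMod p)) {ε : ℝ} (hε₁ : ε ≤ 1) :
    0 ≤ tau1 B ε :=
  div_nonneg (Finset.sum_nonneg fun _ _ => pow_nonneg (sub_nonneg.mpr hε₁) _) (Nat.cast_nonneg _)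

theorem tau1_le {p m n : ℕ} (B : Matrix (Fin m) (Fin n) (ZMod p)) {ε c : ℝ} (hm : 0 < m)
    (h : ∀ i, (1 - ε) ^ hammingNorm (B i) ≤ c) : tau1 B ε ≤ c := by
  rw [tau1, div_le_iff₀ (by exact_mod_cast hm)]
  refine (Finset.sum_le_sum fun i _ => h i).trans (le_of_eq ?_)
  simp [mul_comm]

theorem le_tau1 {p m n : ℕ} (B : Matrix (Fin m) (Fin n) (ZMod p)) {ε c : ℝ} (hm : 0 < m)
    (h : ∀ i, c ≤ (1 - ε) ^ hammingNorm (B i)) : c ≤ tau1 B ε := by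
  rw [tau1, le_div_iff₀ (by exact_mod_cast hm)]
  refine le_trans (le_of_eq ?_) (Finset.sum_le_sum fun i _ => h i)
  simp [mul_comm]

namespace MaxLinSAT

variable {p m n r l : ℕ} [Fact p.Prime] (I : MaxLinSAT p m n)

theorem expectedSatisfied_dqiState (hF : ∀ i, (I.F i).card = r) (hr : 0 < r) (hrp : r < p)
    (hd : ((2 * l + 1 : ℕ) : ℕ∞) < minDistance (dualCode I.B)) (hl : l < m) (ε : ℝ)
    {w : EuclideanSpace ℂ (Fin (l + 1))} (hw : ‖w‖ = 1) :
    I.expectedSatisfied ε (I.dqiState w) =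
      m * (r / p) + Real.sqrt ((r : ℝ) / p * (1 - (r : ℝ) / p)) * tau1 I.B ε *
        complexQuadForm
          (tridiagonal m l (((p : ℝ) - 2 * r) / Real.sqrt (r * ((p : ℝ) - r)))) w := by
  have hp : (0 : ℝ) < p := by exact_mod_cast hr.trans hrp
  have hm : (0 : ℝ) < m := by exact_mod_cast (Nat.zero_le l).trans_lt hl
  have hsp := Real.sqrt_pos.mpr hp
  have hdqi : ∀ x, I.dqiState w x = ∑ k, w k * (I.realBasis k x : ℂ) := fun x => rfl
  have hnorm : ∑ x, Complex.normSq (I.dqiState w x) = 1 := by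
    have h1 := sum_normSq_sum_mul w (fun k : Fin (l + 1) => I.realBasis k) fun _ => 1
    simp only [mul_one, one_mul] at h1
    simp only [hdqi]
    rw [h1]
    have h2 : ∀ k k' : Fin (l + 1), ∑ x, I.realBasis k x * I.realBasis k' x =
        if k = k' then 1 else 0 := fun k k' => by
      rw [I.sum_realBasis_mul hF hr hrp k k' (lt_of_le_of_lt
        (by exact_mod_cast (by omega : _ ≤ _)) hd) (by omega)]
      simp only [Fin.ext_iff]
    have h3 := norm_sq_eq_dotProduct_re_add_im w
    rw [hw, one_pow] at h3
    rw [h3]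
    simp [h2, dotProduct, Finset.sum_add_distrib]
  have hg : ∀ i, ∑ x, Complex.normSq (I.dqiState w x) * I.g i (I.B.mulVec x i) =
      complexQuadForm (tridiagonal m l (((p : ℝ) - 2 * r) / Real.sqrt (r * ((p : ℝ) - r)))) w /
        (m * Real.sqrt p) := by
    intro i
    simp only [hdqi]
    rw [sum_normSq_sum_mul w (fun k : Fin (l + 1) => I.realBasis k)
      fun x => I.g i (I.B.mulVec x i), complexQuadForm_eq_sum,
      Finset.sum_div]
    refine Finset.sum_congr rfl fun k _ => ?_
    rw [Finset.sum_div]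
    refine Finset.sum_congr rfl fun k' _ => ?_
    rw [I.sum_g_mul_realBasis_mul hF hr hrp i k k' hd hl, mul_div_assoc]
  have hs : Real.sqrt ((r : ℝ) / p * (1 - (r : ℝ) / p)) =
      Real.sqrt (r * (p - r) / p) / Real.sqrt p := by
    rw [← Real.sqrt_div' _ hp.le]
    congr 1
    field_simp
  rw [I.expectedSatisfied_eq hF hr hrp, hnorm, mul_one]
  simp only [hg]
  rw [← Finset.sum_mul, hs, tau1]
  field_simp

/-- The form `w†Aw` enters the expectation with a nonnegative factor, so maximizing it is optimal at
every noise level. -/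
theorem isGreatest_achievable (hF : ∀ i, (I.F i).card = r) (hr : 0 < r) (hrp : r < p)
    (hd : ((2 * l + 1 : ℕ) : ℕ∞) < minDistance (dualCode I.B)) (hl : l < m) {ε : ℝ}
    (hε₁ : ε ≤ 1) {lam : ℝ} (hlam : IsTopEigenvalue
      (tridiagonal m l (((p : ℝ) - 2 * r) / Real.sqrt (r * ((p : ℝ) - r)))) lam)
    {w : EuclideanSpace ℂ (Fin (l + 1))} (hw : IsPrincipalEigenvector
      (tridiagonal m l (((p : ℝ) - 2 * r) / Real.sqrt (r * ((p : ℝ) - r)))) w) :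
    IsGreatest (I.achievable l ε) (I.expectedSatisfied ε (I.dqiState w)) := by
  constructor
  · obtain ⟨P, hdeg, hP⟩ := I.exists_polyState_eq_dqiState hF hrp.le w
    exact ⟨P, w, hdeg, hw.1, hP, by rw [hP]⟩
  · rintro s ⟨P, w', -, hw', hP, rfl⟩
    rw [hP, I.expectedSatisfied_dqiState hF hr hrp hd hl ε hw',
      I.expectedSatisfied_dqiState hF hr hrp hd hl ε hw.1, hlam.complexQuadForm_eq hw]
    have := hlam.complexQuadForm_le hw'
    have := tau1_nonneg I.B hε₁
    gcongr

theorem optSatisfied_eq (hF : ∀ i, (I.F i).card = r) (hr : 0 < r) (hrp : r < p)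
    (hd : ((2 * l + 1 : ℕ) : ℕ∞) < minDistance (dualCode I.B)) (hl : l < m) {ε : ℝ}
    (hε₁ : ε ≤ 1) {lam : ℝ} (hlam : IsTopEigenvalue
      (tridiagonal m l (((p : ℝ) - 2 * r) / Real.sqrt (r * ((p : ℝ) - r)))) lam) :
    I.optSatisfied l ε =
      m * (r / p) + Real.sqrt ((r : ℝ) / p * (1 - (r : ℝ) / p)) * tau1 I.B ε * lam := by
  obtain ⟨w, hw⟩ := hlam.exists_isPrincipalEigenvector
  rw [optSatisfied, (I.isGreatest_achievable hF hr hrp hd hl hε₁ hlam hw).csSup_eq,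
    I.expectedSatisfied_dqiState hF hr hrp hd hl ε hw.1, hlam.complexQuadForm_eq hw]

end MaxLinSAT

/-- With `q = r/p` one has `√(q(1-q)) d = 1 - 2q`. -/
theorem bracket_eq_sqrt_mul {p r : ℕ} (hr : 0 < r) (hrp : r < p) {x : ℝ} :
    bracket ((r : ℝ) / p) x = Real.sqrt ((r : ℝ) / p * (1 - (r : ℝ) / p)) *
      (x * (((p : ℝ) - 2 * r) / Real.sqrt (r * ((p : ℝ) - r))) +
        2 * Real.sqrt (x * (1 - x))) := by
  have hp : (0 : ℝ) < p := by exact_mod_cast hr.trans hrp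
  have hr' : (0 : ℝ) < r := by exact_mod_cast hr
  have hrp' : (0 : ℝ) < p - r := sub_pos.mpr (by exact_mod_cast hrp)
  have hs : Real.sqrt ((r : ℝ) / p * (1 - (r : ℝ) / p)) = Real.sqrt (r * (p - r)) / p := by
    rw [show (r : ℝ) / p * (1 - (r : ℝ) / p) = r * (p - r) / p ^ 2 by field_simp,
      Real.sqrt_div' _ (by positivity), Real.sqrt_sq hp.le]
  have h1 := Real.sqrt_pos.mpr (mul_pos hr' hrp')
  rw [bracket, hs]
  field_simp

theorem bracket_nonneg {q x : ℝ} (hq0 : 0 ≤ q) (hq1 : q ≤ 1) (hx : 0 ≤ x) (hx1 : x ≤ 1 - q) :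
    0 ≤ bracket q x := by
  have := bracket_le_bracket hq0 hq1 le_rfl hx hx1
  simpa [bracket] using this

end NoisyDQI

/-! ### The main theorem -/

open NoisyDQI in
theorem mainTheorem2 (p : ℕ) [Fact p.Prime] (r : ℕ) (hr : 1 ≤ r) (hrp : r ≤ p - 1)
    (ε : ℝ) (hε₀ : 0 ≤ ε) (hε₁ : ε ≤ 1)
    (μ : ℝ) (hμ : μ ≤ 1 - (r : ℝ) / (p : ℝ))
    (m n l : ℕ → ℕ) (I : ∀ N, MaxLinSAT p (m N) (n N))
    (hn : ∀ N, 0 < n N) (hmn : ∀ N, n N < m N)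
    (hF : ∀ N i, ((I N).F i).card = r)
    (hd : ∀ N, ((2 * l N + 1 : ℕ) : ℕ∞) < minDistance (dualCode (I N).B))
    (hm : Tendsto m atTop atTop) (hl : Tendsto l atTop atTop)
    (hlm : ∀ N, (l N : ℝ) / (m N : ℝ) = μ) :
    -- the principal eigenvectors of `A` exist, come from polynomials, and are optimal
    (∀ N,
      (∃ w, IsPrincipalEigenvector
        (tridiagonal (m N) (l N) (((p : ℝ) - 2 * r) / Real.sqrt (r * ((p : ℝ) - r)))) w) ∧
      ∀ w, IsPrincipalEigenvector
        (tridiagonal (m N) (l N) (((p : ℝ) - 2 * r) / Real.sqrt (r * ((p : ℝ) - r)))) w →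
        (∃ P : ℂ[X], P.natDegree ≤ l N ∧ (I N).polyState P = (I N).dqiState w) ∧
        IsGreatest ((I N).achievable (l N) ε)
          ((I N).expectedSatisfied ε ((I N).dqiState w))) ∧
    -- the asymptotic value of the optimum, for matrices `B` that vary with `m`
    Tendsto (fun N => (I N).optSatisfied (l N) ε / (m N : ℝ)
        - ((r : ℝ) / p + tau1 (I N).B ε * bracket ((r : ℝ) / p) μ)) atTop (𝓝 0) ∧
    -- in particular the limit of the optimum, when `τ₁(B, ε)` is constant or has a limit
    (∀ τ : ℝ, Tendsto (fun N => tau1 (I N).B ε) atTop (𝓝 τ) →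
      Tendsto (fun N => (I N).optSatisfied (l N) ε / (m N : ℝ)) atTop
        (𝓝 ((r : ℝ) / p + τ * bracket ((r : ℝ) / p) μ))) ∧
    -- the bounds under row-weight bounds, on the lower and upper limits and on the limit
    (∀ L₁ L₂ : ℕ,
      (∀ N i, L₁ ≤ hammingNorm ((I N).B i) ∧ hammingNorm ((I N).B i) ≤ L₂) →
      ((1 - ε) ^ L₂ * bracket ((r : ℝ) / p) μ ≤
          liminf (fun N => (I N).optSatisfied (l N) ε / (m N : ℝ) - (r : ℝ) / p) atTop ∧
        limsup (fun N => (I N).optSatisfied (l N) ε / (m N : ℝ) - (r : ℝ) / p) atTop ≤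
          (1 - ε) ^ L₁ * bracket ((r : ℝ) / p) μ) ∧
      ∀ s : ℝ, Tendsto (fun N => (I N).optSatisfied (l N) ε / (m N : ℝ)) atTop (𝓝 s) →
        (1 - ε) ^ L₂ * bracket ((r : ℝ) / p) μ ≤ s - (r : ℝ) / p ∧
        s - (r : ℝ) / p ≤ (1 - ε) ^ L₁ * bracket ((r : ℝ) / p) μ) := by
  have hr0 : 0 < r := hr
  have hrp0 : r < p := by have := (Fact.out : p.Prime).pos; omega
  have hpR : (0 : ℝ) < p := by exact_mod_cast hr0.trans hrp0
  have hq0 : 0 ≤ (r : ℝ) / p := by positivity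
  have hq1 : (r : ℝ) / p ≤ 1 := (div_le_one hpR).mpr (by exact_mod_cast hrp0.le)
  have hmpos : ∀ N, 0 < m N := fun N => (hn N).trans (hmn N)
  -- Here `2l + 1 < d^⊥ ≤ m`.
  have hlt : ∀ N, l N < m N := fun N => by
    have := Nat.cast_lt.mp ((hd N).trans_le (minDistance_le_length (I N).B (hmn N)))
    omega
  have hμ0 : 0 ≤ μ := by rw [← hlm 0]; positivity
  choose lam hlam using fun N => exists_isTopEigenvalue _ (tridiagonal_isSymm (m N) (l N)
    (((p : ℝ) - 2 * r) / Real.sqrt (r * ((p : ℝ) - r))))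
  set s := Real.sqrt ((r : ℝ) / p * (1 - (r : ℝ) / p)) with hs
  have hspos : 0 < s := Real.sqrt_pos.mpr (mul_pos (by positivity)
    (sub_pos.mpr ((div_lt_one hpR).mpr (by exact_mod_cast hrp0))))
  have hlim : Tendsto (fun N => s * (lam N / (m N : ℝ))) atTop
      (𝓝 (bracket ((r : ℝ) / p) μ)) := by
    rw [bracket_eq_sqrt_mul hr0 hrp0]
    refine (tendsto_topEigenvalue_div hm hl hlt hlm hlam fun x hx hxμ => ?_).const_mul s
    have := bracket_le_bracket hq0 hq1 hx hxμ hμ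
    rw [bracket_eq_sqrt_mul hr0 hrp0, bracket_eq_sqrt_mul hr0 hrp0] at this
    exact le_of_mul_le_mul_left this hspos
  have hopt : ∀ N, (I N).optSatisfied (l N) ε / (m N : ℝ) =
      (r : ℝ) / p + tau1 (I N).B ε * (s * (lam N / (m N : ℝ))) := fun N => by
    have : (m N : ℝ) ≠ 0 := Nat.cast_ne_zero.mpr (hmpos N).ne'
    rw [(I N).optSatisfied_eq (hF N) hr0 hrp0 (hd N) (hlt N) hε₁ (hlam N), ← hs]
    field_simp
  have hmain : Tendsto (fun N => (I N).optSatisfied (l N) ε / (m N : ℝ)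
      - ((r : ℝ) / p + tau1 (I N).B ε * bracket ((r : ℝ) / p) μ)) atTop (𝓝 0) := by
    have h0 : Tendsto (fun N => |s * (lam N / (m N : ℝ)) - bracket ((r : ℝ) / p) μ|) atTop
        (𝓝 0) := by
      simpa using (hlim.sub_const (bracket ((r : ℝ) / p) μ)).abs
    refine squeeze_zero_norm (fun N => ?_) h0
    rw [hopt N, add_sub_add_left_eq_sub, ← mul_sub, norm_mul, Real.norm_eq_abs, Real.norm_eq_abs,
      abs_of_nonneg (tau1_nonneg _ hε₁)]
    -- Because `τ₁ ≤ 1`, the error is at most that of the eigenvalue asymptotics, however `B`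
    -- varies.
    refine mul_le_of_le_one_left (abs_nonneg _) (tau1_le _ (hmpos N) fun i => ?_)
    exact pow_le_one₀ (by linarith) (by linarith)
  refine ⟨fun N => ⟨(hlam N).exists_isPrincipalEigenvector, fun w hw =>
    ⟨(I N).exists_polyState_eq_dqiState (hF N) hrp0.le w,
      (I N).isGreatest_achievable (hF N) hr0 hrp0 (hd N) (hlt N) hε₁ (hlam N) hw⟩⟩,
    hmain, fun τ hτ => ?_, fun L₁ L₂ hL => ?_⟩
  · simpa using hmain.add ((hτ.mul_const (bracket ((r : ℝ) / p) μ)).const_add ((r : ℝ) / p))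
  · have hβ := bracket_nonneg hq0 hq1 hμ0 hμ
    have hlow : ∀ N, (1 - ε) ^ L₂ ≤ tau1 (I N).B ε := fun N => le_tau1 _ (hmpos N) fun i =>
      pow_le_pow_of_le_one (by linarith) (by linarith) (hL N i).2
    have hup : ∀ N, tau1 (I N).B ε ≤ (1 - ε) ^ L₁ := fun N => tau1_le _ (hmpos N) fun i =>
      pow_le_pow_of_le_one (by linarith) (by linarith) (hL N i).1
    set e : ℕ → ℝ := fun N => (I N).optSatisfied (l N) ε / (m N : ℝ)
      - ((r : ℝ) / p + tau1 (I N).B ε * bracket ((r : ℝ) / p) μ) with he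
    have htlow : Tendsto (fun N => (1 - ε) ^ L₂ * bracket ((r : ℝ) / p) μ + e N) atTop
        (𝓝 ((1 - ε) ^ L₂ * bracket ((r : ℝ) / p) μ)) := by
      simpa using hmain.const_add ((1 - ε) ^ L₂ * bracket ((r : ℝ) / p) μ)
    have htup : Tendsto (fun N => (1 - ε) ^ L₁ * bracket ((r : ℝ) / p) μ + e N) atTop
        (𝓝 ((1 - ε) ^ L₁ * bracket ((r : ℝ) / p) μ)) := by
      simpa using hmain.const_add ((1 - ε) ^ L₁ * bracket ((r : ℝ) / p) μ)
    have hle1 : ∀ N, (1 - ε) ^ L₂ * bracket ((r : ℝ) / p) μ + e N ≤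
        (I N).optSatisfied (l N) ε / (m N : ℝ) - (r : ℝ) / p := fun N => by
      have := mul_le_mul_of_nonneg_right (hlow N) hβ
      simp only [he]
      linarith
    have hle2 : ∀ N, (I N).optSatisfied (l N) ε / (m N : ℝ) - (r : ℝ) / p ≤
        (1 - ε) ^ L₁ * bracket ((r : ℝ) / p) μ + e N := fun N => by
      have := mul_le_mul_of_nonneg_right (hup N) hβ
      simp only [he]
      linarith
    -- Real `liminf` and `limsup` compare monotonically only for bounded sequences.
    have hbdd_le : IsBoundedUnder (· ≤ ·) atTop
        fun N => (I N).optSatisfied (l N) ε / (m N : ℝ) - (r : ℝ) / p :=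
      htup.isBoundedUnder_le.mono_le (Eventually.of_forall hle2)
    have hbdd_ge : IsBoundedUnder (· ≥ ·) atTop
        fun N => (I N).optSatisfied (l N) ε / (m N : ℝ) - (r : ℝ) / p :=
      htlow.isBoundedUnder_ge.mono_ge (Eventually.of_forall hle1)
    refine ⟨⟨?_, ?_⟩, fun t ht => ⟨?_, ?_⟩⟩
    · rw [← htlow.liminf_eq]
      exact liminf_le_liminf (Eventually.of_forall hle1) htlow.isBoundedUnder_ge
        hbdd_le.isCoboundedUnder_ge
    · rw [← htup.limsup_eq]
      exact limsup_le_limsup (Eventually.of_forall hle2) hbdd_ge.isCoboundedUnder_le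
        htup.isBoundedUnder_le
    · exact le_of_tendsto_of_tendsto' htlow (ht.sub_const _) hle1
    · exact le_of_tendsto_of_tendsto' (ht.sub_const _) htup hle2
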